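/- Let $n\ge 1$ be an integer and let $p$ be a real number with $p>2$ and $p>n$. Let $a_i\ge 0$ $(i=1,2,\dots)$ be real numbers with $\sum_{i=1}^\infty a_i<\infty$, let $y_i\in\mathbb{R}^n$ be arbitrary points, and let $K:\mathbb{R}^n\to\mathbb{R}$ be an arbitrary concave function. Suppose that the series $\sum_{i=1}^\infty a_i|x-y_i|^{\frac{p-n}{p-1}}$ converges at some point $x\in\mathbb{R}^n$. Then it converges at every point $x\in\mathbb{R}^n$, and the function $$W(x)=-\sum_{i=1}^\infty a_i\,|x-y_i|^{\frac{p-n}{p-1}}+K(x)$$ is $p$-superharmonic in $\mathbb{R}^n$. Here a continuous function $h\in W^{1,p}_{loc}(D)$ on an open set $D\subset\mathbb{R}^n$ is called $p$-harmonic in $D$ if $\int_D|\nabla h|^{p-2}\nabla h\cdot\nabla\phi\,dx=0$ for all $\phi\in C_0^\infty(D)$, where $\nabla h$ is the weak gradient. A function $u:\Omega\to(-\infty,\infty]$ on an open set $\Omega\subset\mathbb{R}^n$ is called $p$-superharmonic in $\Omega$ if (i) $u\not\equiv\infty$; (ii) $u$ is lower semicontinuous in $\Omega$; and (iii) whenever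 $D$ is open with compact closure $\overline D\subset\Omega$ and $h\in C(\overline D)$ is $p$-harmonic in $D$ with $h\le u$ on $\partial D$, then $h\le u$ in $D$. -/

import Mathlib

open MeasureTheory
open scoped ContDiff Gradient

/-- `φ ∈ C₀^∞(Ω)`: smooth with compact support contained in `Ω`. -/
def IsTestFunction {n : ℕ} (Ω : Set (EuclideanSpace ℝ (Fin n)))
    (φ : EuclideanSpace ℝ (Fin n) → ℝ) : Prop :=
  ContDiff ℝ ∞ φ ∧ HasCompactSupport φ ∧ tsupport φ ⊆ Ω

/-- `f ∈ L^p_loc(Ω)`: `f` is `p`-integrable over every compact subset of `Ω`. -/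
def MemLpLoc {n : ℕ} {F : Type*} [NormedAddCommGroup F] (p : ℝ)
    (Ω : Set (EuclideanSpace ℝ (Fin n))) (f : EuclideanSpace ℝ (Fin n) → F) : Prop :=
  ∀ C : Set (EuclideanSpace ℝ (Fin n)), IsCompact C → C ⊆ Ω →
    MemLp f (ENNReal.ofReal p) (volume.restrict C)

/-- `u ∈ W^{1,p}_loc(Ω)` with weak gradient `G`: both `u` and `G` are in `L^p_loc(Ω)`, and
`∫ u ∇φ = -∫ φ G` for every test function `φ`. (The weak gradient is unique almost everywhere
in an open `Ω`; the integrands vanish outside the support of `φ`.) -/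
structure HasWeakGradientLp {n : ℕ} (p : ℝ) (Ω : Set (EuclideanSpace ℝ (Fin n)))
    (u : EuclideanSpace ℝ (Fin n) → ℝ)
    (G : EuclideanSpace ℝ (Fin n) → EuclideanSpace ℝ (Fin n)) : Prop where
  memLpLoc : MemLpLoc p Ω u
  memLpLoc_grad : MemLpLoc p Ω G
  integral_eq : ∀ φ : EuclideanSpace ℝ (Fin n) → ℝ, IsTestFunction Ω φ →
    ∫ x, u x • ∇ φ x = -∫ x, φ x • G x

/-- A function `h`, continuous in the open set `Ω` and in `W^{1,p}_loc(Ω)`, is `p`-harmonic in `Ω`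
if `∫ |∇h|^{p-2} ∇h · ∇φ = 0` for every `φ ∈ C₀^∞(Ω)`. Only the values of `h` in `Ω` matter. -/
def IsPHarmonicOn {n : ℕ} (p : ℝ) (Ω : Set (EuclideanSpace ℝ (Fin n)))
    (h : EuclideanSpace ℝ (Fin n) → ℝ) : Prop :=
  ContinuousOn h Ω ∧
    ∃ G : EuclideanSpace ℝ (Fin n) → EuclideanSpace ℝ (Fin n), HasWeakGradientLp p Ω h G ∧
      ∀ φ : EuclideanSpace ℝ (Fin n) → ℝ, IsTestFunction Ω φ →
        ∫ x, ‖G x‖ ^ (p - 2) * inner ℝ (G x) (∇ φ x) = 0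

/-- `u : Ω → (-∞, ∞]` is `p`-superharmonic in `Ω`: it is not identically `∞`, it is lower
semicontinuous, and it obeys the comparison principle with respect to `p`-harmonic functions in
open sets `D ⊂⊂ Ω` that are continuous up to the boundary. -/
structure IsPSuperharmonicOn {n : ℕ} (p : ℝ) (Ω : Set (EuclideanSpace ℝ (Fin n)))
    (u : EuclideanSpace ℝ (Fin n) → EReal) : Prop where
  ne_bot : ∀ x ∈ Ω, u x ≠ ⊥
  exists_ne_top : ∃ x ∈ Ω, u x ≠ ⊤
  lowerSemicontinuousOn : LowerSemicontinuousOn u Ω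
  comparison : ∀ (D : Set (EuclideanSpace ℝ (Fin n))) (h : EuclideanSpace ℝ (Fin n) → ℝ),
    IsOpen D → IsCompact (closure D) → closure D ⊆ Ω →
    ContinuousOn h (closure D) → IsPHarmonicOn p D h →
    (∀ x ∈ frontier D, (h x : EReal) ≤ u x) → ∀ x ∈ D, (h x : EReal) ≤ u x

/-! The `p`-Laplacian is nonlinear, so sums of supersolutions need not be supersolutions. The remedy
is the stronger condition `ΔU + (p - 2) λ_max(D²U) ≤ 0`. Tested direction by direction it is a
family of inequalities linear in `U`, hence stable under sums and nonnegative multiples. The choice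
`ξ = ∇U` shows that a smooth function satisfying it is a weak supersolution of the `p`-Laplace
equation.

Concave functions satisfy it because `p ≥ 2`. So does the fundamental solution `-|x - y|^α`, `α = (p
- n)/(p - 1)`, away from its pole, with equality in the radial direction. Replacing `|x - y|²` by
`|x - y|² + d` removes the singularity and only helps the inequality
(`isDominativeSuper_neg_norm_sub_sq_add_rpow`). Truncating the series, regularising each term and
mollifying `K` therefore approximates `W` uniformly on compact sets by smooth dominative
supersolutions (`exists_isDominativeSuper_approx`).

The comparison principle is proved for these smooth functions (`IsPHarmonicOn.le_of_le_frontier`):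
if `h - U` were positive somewhere, the equation for `h` and the inequality for `U`, tested with a
smooth truncation of the difference, would contradict the strict monotonicity of `a ↦ |a|^(p-2) a`.
Uniform approximation on the closure of `D` carries the comparison over to `W`. -/

/-- The Laplacian as the trace of the second derivative in the standard basis. -/
noncomputable def hessianTrace {n : ℕ} (U : EuclideanSpace ℝ (Fin n) → ℝ)
    (x : EuclideanSpace ℝ (Fin n)) : ℝ :=
  ∑ i, fderiv ℝ (fderiv ℝ U) x (EuclideanSpace.basisFun (Fin n) ℝ i)
    (EuclideanSpace.basisFun (Fin n) ℝ i)

/-- Smooth supersolutions of the dominative `p`-Laplace equation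
`ΔU + (p - 2) λ_max(D²U) ≤ 0`, written out through the quadratic form of the Hessian. -/
structure IsDominativeSuper {n : ℕ} (p : ℝ) (U : EuclideanSpace ℝ (Fin n) → ℝ) : Prop where
  contDiff : ContDiff ℝ ∞ U
  hessian_le : ∀ x ξ, ‖ξ‖ ^ 2 * hessianTrace U x + (p - 2) * fderiv ℝ (fderiv ℝ U) x ξ ξ ≤ 0

/-! ### Dominative supersolutions: algebra and basic examples -/

section Dominative

variable {n : ℕ} {p : ℝ}

theorem ContDiff.differentiable_fderiv_of_smooth {U : EuclideanSpace ℝ (Fin n) → ℝ}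
    (hU : ContDiff ℝ ∞ U) : Differentiable ℝ (fderiv ℝ U) :=
  (hU.fderiv_right (m := 1) (by norm_cast)).differentiable one_ne_zero

theorem fderiv_fderiv_add {U V : EuclideanSpace ℝ (Fin n) → ℝ} (hU : ContDiff ℝ ∞ U)
    (hV : ContDiff ℝ ∞ V) (x : EuclideanSpace ℝ (Fin n)) :
    fderiv ℝ (fderiv ℝ (fun z => U z + V z)) x =
      fderiv ℝ (fderiv ℝ U) x + fderiv ℝ (fderiv ℝ V) x := by
  have h : fderiv ℝ (fun z => U z + V z) = fun z => fderiv ℝ U z + fderiv ℝ V z := by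
    funext z
    exact fderiv_fun_add (hU.differentiable (by simp) z) (hV.differentiable (by simp) z)
  rw [h]
  exact fderiv_fun_add (hU.differentiable_fderiv_of_smooth x)
    (hV.differentiable_fderiv_of_smooth x)

theorem fderiv_fderiv_const_mul {U : EuclideanSpace ℝ (Fin n) → ℝ} (hU : ContDiff ℝ ∞ U) (c : ℝ)
    (x : EuclideanSpace ℝ (Fin n)) :
    fderiv ℝ (fderiv ℝ (fun z => c * U z)) x = c • fderiv ℝ (fderiv ℝ U) x := by
  have h : fderiv ℝ (fun z => c * U z) = fun z => c • fderiv ℝ U z := by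
    funext z
    exact fderiv_const_mul (hU.differentiable (by simp) z) c
  rw [h]
  exact fderiv_fun_const_smul (hU.differentiable_fderiv_of_smooth x) c

theorem IsDominativeSuper.add {U V : EuclideanSpace ℝ (Fin n) → ℝ} (hU : IsDominativeSuper p U)
    (hV : IsDominativeSuper p V) : IsDominativeSuper p fun x => U x + V x where
  contDiff := hU.contDiff.add hV.contDiff
  hessian_le x ξ := by
    have h1 := hU.hessian_le x ξ
    have h2 := hV.hessian_le x ξ
    simp only [hessianTrace] at h1 h2 ⊢
    rw [fderiv_fderiv_add hU.contDiff hV.contDiff]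
    simp only [add_apply, Finset.sum_add_distrib]
    linarith

theorem IsDominativeSuper.const_mul {U : EuclideanSpace ℝ (Fin n) → ℝ}
    (hU : IsDominativeSuper p U) {c : ℝ} (hc : 0 ≤ c) :
    IsDominativeSuper p fun x => c * U x where
  contDiff := contDiff_const.mul hU.contDiff
  hessian_le x ξ := by
    have h1 := mul_nonpos_of_nonneg_of_nonpos hc (hU.hessian_le x ξ)
    simp only [hessianTrace] at h1 ⊢
    rw [fderiv_fderiv_const_mul hU.contDiff]
    simp only [smul_apply, smul_eq_mul, ← Finset.mul_sum]
    linarith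

theorem isDominativeSuper_zero :
    IsDominativeSuper p fun _ : EuclideanSpace ℝ (Fin n) => (0 : ℝ) where
  contDiff := contDiff_const
  hessian_le x ξ := by simp [hessianTrace]

theorem IsDominativeSuper.sum {ι : Type*} (s : Finset ι)
    {U : ι → EuclideanSpace ℝ (Fin n) → ℝ} (hU : ∀ i ∈ s, IsDominativeSuper p (U i)) :
    IsDominativeSuper p fun x => ∑ i ∈ s, U i x := by
  classical
  induction s using Finset.induction_on with
  | empty => simpa using isDominativeSuper_zero
  | insert i s hi ih =>
    simp only [Finset.sum_insert hi]
    exact (hU i (Finset.mem_insert_self i s)).add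
      (ih fun j hj => hU j (Finset.mem_insert_of_mem hj))

/-- Restricted to the line `t ↦ x + t ξ`, concavity makes the first derivative nonincreasing, and
the second derivative at `t = 0` is the quadratic form. -/
theorem fderiv_fderiv_nonpos_of_concave {U : EuclideanSpace ℝ (Fin n) → ℝ}
    (hU : ContDiff ℝ ∞ U) (hc : ConcaveOn ℝ Set.univ U) (x ξ : EuclideanSpace ℝ (Fin n)) :
    fderiv ℝ (fderiv ℝ U) x ξ ξ ≤ 0 := by
  have hline : ∀ t : ℝ, HasDerivAt (fun t : ℝ => x + t • ξ) ξ t := fun t => by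
    simpa using ((hasDerivAt_id t).smul_const ξ).const_add x
  have h1 : ∀ t, HasDerivAt (fun t : ℝ => U (x + t • ξ)) (fderiv ℝ U (x + t • ξ) ξ) t := fun t =>
    (hU.differentiable (by simp) _).hasFDerivAt.comp_hasDerivAt t (hline t)
  have h2 : HasDerivAt (fun t : ℝ => fderiv ℝ U (x + t • ξ) ξ)
      (fderiv ℝ (fderiv ℝ U) x ξ ξ) 0 := by
    have h := (hU.differentiable_fderiv_of_smooth (x + (0 : ℝ) • ξ)).hasFDerivAt.comp_hasDerivAt 0
      (hline 0)
    simpa using h.clm_apply (hasDerivAt_const (0 : ℝ) ξ)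
  have hconc : ConcaveOn ℝ Set.univ fun t : ℝ => U (x + t • ξ) := by
    refine ⟨convex_univ, fun s _ t _ a b ha hb hab => ?_⟩
    have := hc.2 (Set.mem_univ (x + s • ξ)) (Set.mem_univ (x + t • ξ)) ha hb hab
    have e : a • (x + s • ξ) + b • (x + t • ξ) = x + (a • s + b • t) • ξ := by
      have : x = (a + b) • x := by rw [hab, one_smul]
      rw [smul_add, smul_add, add_smul]
      nth_rw 3 [this]
      simp only [add_smul, smul_assoc]
      abel
    rwa [e] at this
  have hanti : Antitone fun t : ℝ => fderiv ℝ U (x + t • ξ) ξ := by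
    have := hconc.antitoneOn_deriv fun t _ => (h1 t).differentiableAt
    have e : deriv (fun t : ℝ => U (x + t • ξ)) = fun t => fderiv ℝ U (x + t • ξ) ξ :=
      funext fun t => (h1 t).deriv
    rw [e] at this
    exact antitoneOn_univ.1 this
  rw [← h2.deriv]
  exact hanti.deriv_nonpos

theorem IsDominativeSuper.of_concave (hp : 2 ≤ p) {U : EuclideanSpace ℝ (Fin n) → ℝ}
    (hU : ContDiff ℝ ∞ U) (hc : ConcaveOn ℝ Set.univ U) : IsDominativeSuper p U where
  contDiff := hU
  hessian_le x ξ := by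
    have h1 : hessianTrace U x ≤ 0 :=
      Finset.sum_nonpos fun i _ => fderiv_fderiv_nonpos_of_concave hU hc x _
    have h2 := fderiv_fderiv_nonpos_of_concave hU hc x ξ
    have := mul_nonpos_of_nonneg_of_nonpos (sq_nonneg ‖ξ‖) h1
    have := mul_nonpos_of_nonneg_of_nonpos (sub_nonneg.2 hp) h2
    linarith

theorem hasFDerivAt_norm_sub_sq_add_rpow (y x : EuclideanSpace ℝ (Fin n)) {d : ℝ} (hd : 0 < d)
    (β : ℝ) :
    HasFDerivAt (fun x => (‖x - y‖ ^ 2 + d) ^ β)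
      ((2 * β * (‖x - y‖ ^ 2 + d) ^ (β - 1)) • innerSL ℝ (x - y)) x := by
  have h := (((hasFDerivAt_id x).sub_const y).norm_sq.add_const d).rpow_const (p := β)
    (Or.inl (by positivity))
  refine h.congr_fderiv ?_
  ext v
  simp
  ring

theorem fderiv_fderiv_norm_sub_sq_add_rpow (y x v w : EuclideanSpace ℝ (Fin n)) {d : ℝ}
    (hd : 0 < d) (β : ℝ) :
    fderiv ℝ (fderiv ℝ fun x => (‖x - y‖ ^ 2 + d) ^ β) x v w =
      2 * β * (‖x - y‖ ^ 2 + d) ^ (β - 1) * inner ℝ v w +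
      4 * β * (β - 1) * (‖x - y‖ ^ 2 + d) ^ (β - 2) * inner ℝ (x - y) v * inner ℝ (x - y) w := by
  have e : (fderiv ℝ fun x => (‖x - y‖ ^ 2 + d) ^ β) = fun x =>
      (2 * β * (‖x - y‖ ^ 2 + d) ^ (β - 1)) • innerSL ℝ (x - y) :=
    funext fun z => (hasFDerivAt_norm_sub_sq_add_rpow y z hd β).fderiv
  have h1 := (hasFDerivAt_norm_sub_sq_add_rpow y x hd (β - 1)).const_mul (2 * β)
  -- Over `ℝ` the conjugate-linear `innerSL` is linear; retyping it as such lets the product rule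
  -- apply.
  obtain ⟨L, hL⟩ : ∃ L : EuclideanSpace ℝ (Fin n) →L[ℝ] EuclideanSpace ℝ (Fin n) →L[ℝ] ℝ,
      ∀ v, L v = innerSL ℝ v := ⟨innerSL ℝ, fun _ => rfl⟩
  simp only [← hL] at e h1
  have h2 : HasFDerivAt (fun x => L (x - y)) L x :=
    L.hasFDerivAt.comp x ((hasFDerivAt_id x).sub_const y)
  rw [e, (h1.fun_smul h2).fderiv]
  rw [show β - 1 - 1 = β - 2 by ring]
  simp only [add_apply, smul_apply, ContinuousLinearMap.smulRight_apply, hL, innerSL_apply_apply,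
    smul_eq_mul]
  ring

/-- Since the exponent is at most `1`, Cauchy–Schwarz makes the radial direction the worst one.
There the terms in `|x - y|²` cancel exactly, by the choice of exponent, and a nonnegative multiple
of `d` is left. -/
theorem isDominativeSuper_neg_norm_sub_sq_add_rpow (hp : 2 < p) (hpn : (n : ℝ) < p) (hn : 1 ≤ n)
    (y : EuclideanSpace ℝ (Fin n)) {d : ℝ} (hd : 0 < d) :
    IsDominativeSuper p fun x => -(‖x - y‖ ^ 2 + d) ^ ((p - n) / (p - 1) / 2) := by
  set β := (p - n) / (p - 1) / 2 with hβ
  have hn' : (1 : ℝ) ≤ n := by exact_mod_cast hn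
  have hβ0 : 0 < β := div_pos (div_pos (by linarith) (by linarith)) two_pos
  have hβ2 : 2 * β * (p - 1) = p - n := by rw [hβ]; field_simp [show p - 1 ≠ 0 by linarith]
  have hβ1 : β ≤ 1 := by nlinarith
  have hsm : ContDiff ℝ ∞ fun x : EuclideanSpace ℝ (Fin n) => (‖x - y‖ ^ 2 + d) ^ β :=
    (((contDiff_id.sub contDiff_const).norm_sq ℝ).add contDiff_const).rpow_const_of_ne
      fun x => by positivity
  refine ⟨hsm.neg, fun x ξ => ?_⟩
  set q := ‖x - y‖ ^ 2 + d with hq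
  have hq0 : 0 < q := by positivity
  have hH : ∀ v w, fderiv ℝ (fderiv ℝ fun x => -(‖x - y‖ ^ 2 + d) ^ β) x v w =
      -(2 * β * q ^ (β - 1) * inner ℝ v w +
      4 * β * (β - 1) * q ^ (β - 2) * inner ℝ (x - y) v * inner ℝ (x - y) w) := fun v w => by
    have := fderiv_fderiv_const_mul hsm (-1) x
    simp only [neg_one_mul] at this
    rw [this]
    rw [smul_apply, smul_apply, smul_eq_mul, neg_one_mul,
      fderiv_fderiv_norm_sub_sq_add_rpow y x v w hd]
  have htr : hessianTrace (fun x => -(‖x - y‖ ^ 2 + d) ^ β) x =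
      -(2 * β * q ^ (β - 1) * n + 4 * β * (β - 1) * q ^ (β - 2) * ‖x - y‖ ^ 2) := by
    simp only [hessianTrace, hH]
    rw [Finset.sum_neg_distrib, Finset.sum_add_distrib, ← Finset.mul_sum]
    have e1 : ∑ i : Fin n, inner ℝ (EuclideanSpace.basisFun (Fin n) ℝ i)
        (EuclideanSpace.basisFun (Fin n) ℝ i) = (n : ℝ) := by simp
    have e2 : ∑ i : Fin n, inner ℝ (x - y) (EuclideanSpace.basisFun (Fin n) ℝ i) ^ 2
        = ‖x - y‖ ^ 2 := by
      simp [EuclideanSpace.norm_sq_eq, EuclideanSpace.inner_single_right]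
    rw [e1, ← e2, Finset.mul_sum]
    congr 3
    funext i
    ring
  rw [htr, hH]
  have hq1 : q ^ (β - 1) = q ^ (β - 2) * q := by
    rw [← Real.rpow_add_one hq0.ne']
    ring_nf
  have hcs : inner ℝ (x - y) ξ * inner ℝ (x - y) ξ ≤ ‖x - y‖ ^ 2 * ‖ξ‖ ^ 2 := by
    have := real_inner_mul_inner_self_le (x - y) ξ
    simpa only [real_inner_self_eq_norm_sq] using this
  have hpos : 0 < q ^ (β - 2) := Real.rpow_pos_of_pos hq0 _
  rw [hq1, real_inner_self_eq_norm_sq]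
  set I := inner ℝ (x - y) ξ * inner ℝ (x - y) ξ
  set N := ‖ξ‖ ^ 2 with hN
  set s := ‖x - y‖ ^ 2
  have hN0 : 0 ≤ N := sq_nonneg _
  -- What remains after factoring `2 β q^(β - 2)` out of the inequality and changing its sign.
  have key : 0 ≤ N * (q * n + 2 * (β - 1) * s) + (p - 2) * (q * N + 2 * (β - 1) * I) := by
    have h1 : (1 - β) * ((p - 2) * I) ≤ (1 - β) * ((p - 2) * (s * N)) :=
      mul_le_mul_of_nonneg_left (mul_le_mul_of_nonneg_left hcs (by linarith)) (by linarith)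
    have h2 : 0 ≤ N * d * (n + p - 2) := by
      have : 0 ≤ (n : ℝ) + p - 2 := by linarith
      positivity
    have h3 : N * (q * n + 2 * (β - 1) * s) + (p - 2) * (q * N + 2 * (β - 1) * (s * N)) =
        N * d * (n + p - 2) := by
      rw [hq]
      linear_combination N * s * hβ2
    linarith
  have := mul_nonneg (mul_nonneg (mul_nonneg two_pos.le hβ0.le) hpos.le) key
  linarith

end Dominative

/-! ### Gradients in coordinates -/

section Gradient

variable {n : ℕ}

theorem ContDiff.continuous_gradient {f : EuclideanSpace ℝ (Fin n) → ℝ} (hf : ContDiff ℝ 1 f) :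
    Continuous (∇ f) :=
  (InnerProductSpace.toDual ℝ (EuclideanSpace ℝ (Fin n))).symm.continuous.comp
    (hf.continuous_fderiv one_ne_zero)

theorem gradient_eq_zero_of_notMem_tsupport {f : EuclideanSpace ℝ (Fin n) → ℝ}
    {x : EuclideanSpace ℝ (Fin n)} (hx : x ∉ tsupport f) : ∇ f x = 0 := by
  rw [gradient, fderiv_of_notMem_tsupport ℝ hx, map_zero]

theorem HasCompactSupport.gradient {f : EuclideanSpace ℝ (Fin n) → ℝ} (hf : HasCompactSupport f) :
    HasCompactSupport (∇ f) :=
  HasCompactSupport.intro hf fun _ hx => gradient_eq_zero_of_notMem_tsupport hx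

theorem inner_eq_sum_basisFun (v w : EuclideanSpace ℝ (Fin n)) :
    inner ℝ v w = ∑ i, inner ℝ v (EuclideanSpace.basisFun (Fin n) ℝ i) *
      inner ℝ w (EuclideanSpace.basisFun (Fin n) ℝ i) := by
  rw [← (EuclideanSpace.basisFun (Fin n) ℝ).sum_inner_mul_inner v w]
  simp_rw [real_inner_comm w]

theorem gradient_eq_sum (f : EuclideanSpace ℝ (Fin n) → ℝ) (x : EuclideanSpace ℝ (Fin n)) :
    ∇ f x = ∑ i, fderiv ℝ f x (EuclideanSpace.basisFun (Fin n) ℝ i) •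
      EuclideanSpace.basisFun (Fin n) ℝ i := by
  rw [← (EuclideanSpace.basisFun (Fin n) ℝ).sum_repr' (∇ f x)]
  simp_rw [real_inner_comm, inner_gradient_left]

end Gradient

/-! ### From the dominative inequality to weak supersolutions -/

section Dominative

variable {n : ℕ} {p : ℝ}

/-- Summing the inequality over an orthonormal basis gives `(n + p - 2) ΔU ≤ 0`. -/
theorem IsDominativeSuper.hessianTrace_nonpos {U : EuclideanSpace ℝ (Fin n) → ℝ} (hp : 2 < p)
    (hU : IsDominativeSuper p U) (x : EuclideanSpace ℝ (Fin n)) : hessianTrace U x ≤ 0 := by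
  have h := Finset.sum_nonpos fun i (_ : i ∈ Finset.univ) =>
    hU.hessian_le x (EuclideanSpace.basisFun (Fin n) ℝ i)
  rw [Finset.sum_add_distrib, ← Finset.mul_sum] at h
  simp only [OrthonormalBasis.norm_eq_one, one_pow, one_mul, Finset.sum_const, Finset.card_univ,
    Fintype.card_fin, nsmul_eq_mul] at h
  change n * hessianTrace U x + (p - 2) * hessianTrace U x ≤ 0 at h
  have hn : (0 : ℝ) ≤ n := Nat.cast_nonneg n
  by_contra! hc
  nlinarith [mul_nonneg hn hc.le, mul_pos (sub_pos.2 hp) hc]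

theorem hasFDerivAt_fderiv_apply {U : EuclideanSpace ℝ (Fin n) → ℝ} (hU : ContDiff ℝ ∞ U)
    (x v : EuclideanSpace ℝ (Fin n)) :
    HasFDerivAt (fun x => fderiv ℝ U x v) ((fderiv ℝ (fderiv ℝ U) x).flip v) x := by
  have h := (hU.differentiable_fderiv_of_smooth x).hasFDerivAt.clm_apply (hasFDerivAt_const v x)
  refine h.congr_fderiv ?_
  ext w
  simp

theorem contDiff_fderiv_apply {U : EuclideanSpace ℝ (Fin n) → ℝ} (hU : ContDiff ℝ ∞ U)
    (v : EuclideanSpace ℝ (Fin n)) : ContDiff ℝ 1 (fun x => fderiv ℝ U x v) :=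
  (hU.fderiv_right (m := 1) (by norm_cast)).clm_apply contDiff_const

theorem norm_gradient_sq (U : EuclideanSpace ℝ (Fin n) → ℝ) (x : EuclideanSpace ℝ (Fin n)) :
    ‖∇ U x‖ ^ 2 = ∑ j, fderiv ℝ U x (EuclideanSpace.basisFun (Fin n) ℝ j) ^ 2 := by
  rw [← real_inner_self_eq_norm_sq, inner_eq_sum_basisFun]
  simp_rw [inner_gradient_left, sq]

/-- The derivative of the regularised factor `(|∇U|² + d)^s`. -/
theorem hasFDerivAt_norm_gradient_sq_add_rpow {U : EuclideanSpace ℝ (Fin n) → ℝ}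
    (hU : ContDiff ℝ ∞ U) {d : ℝ} (hd : 0 < d) (s : ℝ) (x : EuclideanSpace ℝ (Fin n)) :
    HasFDerivAt (fun x => (‖∇ U x‖ ^ 2 + d) ^ s)
      ((2 * s * (‖∇ U x‖ ^ 2 + d) ^ (s - 1)) • (fderiv ℝ (fderiv ℝ U) x).flip (∇ U x)) x := by
  have h1 : HasFDerivAt (fun x => ‖∇ U x‖ ^ 2 + d)
      ((2 : ℝ) • (fderiv ℝ (fderiv ℝ U) x).flip (∇ U x)) x := by
    simp only [norm_gradient_sq]
    have h := (HasFDerivAt.fun_sum (u := Finset.univ) fun j _ =>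
      (hasFDerivAt_fderiv_apply hU x (EuclideanSpace.basisFun (Fin n) ℝ j)).pow 2).add_const d
    refine h.congr_fderiv ?_
    rw [gradient_eq_sum, map_sum, Finset.smul_sum]
    refine Finset.sum_congr rfl fun j _ => ?_
    rw [map_smul, smul_smul]
    simp
  refine (h1.rpow_const (p := s) (Or.inl (by positivity))).congr_fderiv ?_
  rw [smul_smul]
  congr 1
  ring

/-- With `q = |∇U|² + d`, the divergence of the flux is `q^(s-1) (|∇U|² ΔU + (p - 2) D²U(∇U, ∇U) + d
ΔU)`: the first two terms are the hypothesis at `ξ = ∇U`, the last is controlled by the trace. The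
shift `d` keeps the flux differentiable at critical points of `U`. -/
theorem IsDominativeSuper.integral_regularized_nonneg {U : EuclideanSpace ℝ (Fin n) → ℝ}
    (hp : 2 < p) (hU : IsDominativeSuper p U) {φ : EuclideanSpace ℝ (Fin n) → ℝ}
    (hφ : ContDiff ℝ ∞ φ) (hφc : HasCompactSupport φ) (hφ0 : ∀ x, 0 ≤ φ x) {d : ℝ} (hd : 0 < d) :
    0 ≤ ∫ x, (‖∇ U x‖ ^ 2 + d) ^ ((p - 2) / 2) * inner ℝ (∇ U x) (∇ φ x) := by
  set s := (p - 2) / 2 with hs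
  have hUs := hU.contDiff
  let e := EuclideanSpace.basisFun (Fin n) ℝ
  have hq : ∀ x, 0 < ‖∇ U x‖ ^ 2 + d := fun x => by positivity
  have hg : Continuous fun x => ‖∇ U x‖ ^ 2 + d :=
    ((hUs.of_le (by simp)).continuous_gradient.norm.pow 2).add continuous_const
  have hpow : ∀ r : ℝ, Continuous fun x => (‖∇ U x‖ ^ 2 + d) ^ r := fun r =>
    hg.rpow_const fun x => Or.inl (hq x).ne'
  have hu : ∀ i, Continuous fun x => fderiv ℝ U x (e i) := fun i =>
    (contDiff_fderiv_apply hUs (e i)).continuous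
  have hφ' : ∀ i, Continuous fun x => fderiv ℝ φ x (e i) := fun i =>
    (contDiff_fderiv_apply hφ (e i)).continuous
  have hφ'c : ∀ i, HasCompactSupport fun x => fderiv ℝ φ x (e i) := fun i =>
    hφc.fderiv_apply ℝ (e i)
  have hD2 : Continuous (fderiv ℝ (fderiv ℝ U)) :=
    (hUs.fderiv_right (m := 1) (by norm_cast)).continuous_fderiv one_ne_zero
  have hD2' : ∀ i, Continuous fun x => fderiv ℝ (fderiv ℝ U) x (e i) (∇ U x) := fun i =>
    (hD2.clm_apply continuous_const).clm_apply (hUs.of_le (by simp)).continuous_gradient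
  have hD2'' : ∀ i, Continuous fun x => fderiv ℝ (fderiv ℝ U) x (e i) (e i) := fun i =>
    (hD2.clm_apply continuous_const).clm_apply continuous_const
  -- the derivative of each component of the regularised flux
  have hF : ∀ i x, HasFDerivAt (fun x => (‖∇ U x‖ ^ 2 + d) ^ s * fderiv ℝ U x (e i))
      ((‖∇ U x‖ ^ 2 + d) ^ s • (fderiv ℝ (fderiv ℝ U) x).flip (e i) +
        fderiv ℝ U x (e i) • ((2 * s * (‖∇ U x‖ ^ 2 + d) ^ (s - 1)) •
          (fderiv ℝ (fderiv ℝ U) x).flip (∇ U x))) x := fun i x =>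
    (hasFDerivAt_norm_gradient_sq_add_rpow hUs hd s x).mul (hasFDerivAt_fderiv_apply hUs x (e i))
  have hF' : ∀ i x, fderiv ℝ (fun x => (‖∇ U x‖ ^ 2 + d) ^ s * fderiv ℝ U x (e i)) x (e i) =
      (‖∇ U x‖ ^ 2 + d) ^ s * fderiv ℝ (fderiv ℝ U) x (e i) (e i) +
        2 * s * (‖∇ U x‖ ^ 2 + d) ^ (s - 1) *
          (fderiv ℝ U x (e i) * fderiv ℝ (fderiv ℝ U) x (e i) (∇ U x)) := fun i x => by
    rw [(hF i x).fderiv]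
    simp only [add_apply, smul_apply, ContinuousLinearMap.flip_apply, smul_eq_mul]
    ring
  have hFc : ∀ i, Continuous fun x =>
      fderiv ℝ (fun x => (‖∇ U x‖ ^ 2 + d) ^ s * fderiv ℝ U x (e i)) x (e i) := fun i => by
    simp only [hF']
    exact ((hpow s).mul (hD2'' i)).add
      ((continuous_const.mul (hpow (s - 1))).mul ((hu i).mul (hD2' i)))
  have hint : ∀ i, Integrable fun x =>
      fderiv ℝ (fun x => (‖∇ U x‖ ^ 2 + d) ^ s * fderiv ℝ U x (e i)) x (e i) * φ x := fun i =>
    ((hFc i).mul hφ.continuous).integrable_of_hasCompactSupport hφc.mul_left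
  have hint' : ∀ i, Integrable fun x =>
      (‖∇ U x‖ ^ 2 + d) ^ s * fderiv ℝ U x (e i) * fderiv ℝ φ x (e i) := fun i =>
    (((hpow s).mul (hu i)).mul (hφ' i)).integrable_of_hasCompactSupport (hφ'c i).mul_left
  have hparts : ∀ i, ∫ x, (‖∇ U x‖ ^ 2 + d) ^ s * fderiv ℝ U x (e i) * fderiv ℝ φ x (e i) =
      -∫ x, fderiv ℝ (fun x => (‖∇ U x‖ ^ 2 + d) ^ s * fderiv ℝ U x (e i)) x (e i) * φ x :=
    fun i => integral_mul_fderiv_eq_neg_fderiv_mul_of_integrable (hint i) (hint' i)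
      ((((hpow s).mul (hu i)).mul hφ.continuous).integrable_of_hasCompactSupport hφc.mul_left)
      (fun x _ => (hF i x).differentiableAt) (fun x _ => hφ.differentiable (by simp) x)
  have hsum : ∀ x, (‖∇ U x‖ ^ 2 + d) ^ s * inner ℝ (∇ U x) (∇ φ x) =
      ∑ i, (‖∇ U x‖ ^ 2 + d) ^ s * fderiv ℝ U x (e i) * fderiv ℝ φ x (e i) := fun x => by
    rw [inner_eq_sum_basisFun, Finset.mul_sum]
    simp_rw [inner_gradient_left, mul_assoc]
    rfl
  simp_rw [hsum]
  rw [integral_finsetSum _ fun i _ => hint' i]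
  simp_rw [hparts]
  rw [Finset.sum_neg_distrib, ← integral_finsetSum _ fun i _ => hint i, neg_nonneg]
  refine integral_nonpos fun x => ?_
  simp only [Pi.zero_apply]
  rw [← Finset.sum_mul]
  refine mul_nonpos_of_nonpos_of_nonneg ?_ (hφ0 x)
  simp_rw [hF']
  rw [Finset.sum_add_distrib, ← Finset.mul_sum, ← Finset.mul_sum]
  have e1 : ∑ i, fderiv ℝ U x (e i) * fderiv ℝ (fderiv ℝ U) x (e i) (∇ U x) =
      fderiv ℝ (fderiv ℝ U) x (∇ U x) (∇ U x) := by
    nth_rw 2 [gradient_eq_sum]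
    rw [map_sum, sum_apply]
    simp [e]
  have e2 : (‖∇ U x‖ ^ 2 + d) ^ s = (‖∇ U x‖ ^ 2 + d) ^ (s - 1) * (‖∇ U x‖ ^ 2 + d) := by
    rw [← Real.rpow_add_one (hq x).ne', sub_add_cancel]
  rw [e1, e2]
  have h1 := hU.hessian_le x (∇ U x)
  have h2 := mul_nonpos_of_nonneg_of_nonpos hd.le (hU.hessianTrace_nonpos hp x)
  have h3 := mul_nonpos_of_nonneg_of_nonpos (Real.rpow_nonneg (hq x).le (s - 1)) (add_nonpos h1 h2)
  change _ * hessianTrace U x + _ ≤ 0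
  have : 2 * s = p - 2 := by rw [hs]; ring
  rw [this]
  linarith

/-- Smooth dominative supersolutions are weak supersolutions of the `p`-Laplace equation. -/
theorem IsDominativeSuper.integral_nonneg {U : EuclideanSpace ℝ (Fin n) → ℝ}
    (hp : 2 < p) (hU : IsDominativeSuper p U) {φ : EuclideanSpace ℝ (Fin n) → ℝ}
    (hφ : ContDiff ℝ ∞ φ) (hφc : HasCompactSupport φ) (hφ0 : ∀ x, 0 ≤ φ x) :
    0 ≤ ∫ x, ‖∇ U x‖ ^ (p - 2) * inner ℝ (∇ U x) (∇ φ x) := by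
  have hgU : Continuous (∇ U) := (hU.contDiff.of_le (by simp)).continuous_gradient
  have hgφ : Continuous (∇ φ) := (hφ.of_le (by simp)).continuous_gradient
  have hs : 0 < (p - 2) / 2 := by linarith
  have hcont : ∀ d : ℝ, 0 ≤ d → Continuous fun x =>
      (‖∇ U x‖ ^ 2 + d) ^ ((p - 2) / 2) * inner ℝ (∇ U x) (∇ φ x) := fun d _ =>
    ((((hgU.norm.pow 2).add continuous_const).rpow_const fun x => Or.inr hs.le)).mul
      (hgU.inner hgφ)
  have hsupp : ∀ x, x ∉ tsupport φ → inner ℝ (∇ U x) (∇ φ x) = 0 := fun x hx => by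
    rw [gradient_eq_zero_of_notMem_tsupport hx, inner_zero_right]
  have hlim : Filter.Tendsto (fun k : ℕ => ∫ x,
      (‖∇ U x‖ ^ 2 + 1 / ((k : ℝ) + 1)) ^ ((p - 2) / 2) * inner ℝ (∇ U x) (∇ φ x)) Filter.atTop
      (nhds (∫ x, ‖∇ U x‖ ^ (p - 2) * inner ℝ (∇ U x) (∇ φ x))) := by
    -- The shifts `1/(k+1)` are at most `1` and the exponent is positive, so the integrand with
    -- shift `1` dominates.
    refine tendsto_integral_of_dominated_convergence
      (fun x => ‖(‖∇ U x‖ ^ 2 + 1) ^ ((p - 2) / 2) * inner ℝ (∇ U x) (∇ φ x)‖)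
      (fun k => (hcont _ (by positivity)).aestronglyMeasurable) ?_ ?_ ?_
    · refine ((hcont 1 zero_le_one).integrable_of_hasCompactSupport
        (HasCompactSupport.intro hφc fun x hx => ?_)).norm
      rw [hsupp x hx, mul_zero]
    · refine fun k => Filter.Eventually.of_forall fun x => ?_
      rw [norm_mul, norm_mul]
      refine mul_le_mul_of_nonneg_right ?_ (norm_nonneg _)
      rw [Real.norm_of_nonneg (by positivity), Real.norm_of_nonneg (by positivity)]
      refine Real.rpow_le_rpow (by positivity) ?_ hs.le
      gcongr
      rw [div_le_one (by positivity)]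
      linarith [(Nat.cast_nonneg k : (0 : ℝ) ≤ k)]
    · refine Filter.Eventually.of_forall fun x => Filter.Tendsto.mul_const _ ?_
      have h0 : ‖∇ U x‖ ^ (p - 2) = (‖∇ U x‖ ^ 2 + 0) ^ ((p - 2) / 2) := by
        rw [add_zero, ← Real.rpow_natCast, ← Real.rpow_mul (norm_nonneg _)]
        congr 1
        push_cast
        ring
      rw [h0]
      exact (tendsto_one_div_add_atTop_nhds_zero_nat.const_add _).rpow_const (Or.inr hs.le)
  exact ge_of_tendsto' hlim fun k =>
    hU.integral_regularized_nonneg hp hφ hφc hφ0 (by positivity)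

end Dominative

/-! ### Mollification: uniform and `L^p` convergence, gradients, concavity -/

section Mollify

open ContinuousLinearMap Filter Topology
open scoped Convolution ENNReal

variable {n : ℕ} {F : Type*} [NormedAddCommGroup F] [NormedSpace ℝ F]

/-- Bump functions shrinking to the origin. -/
noncomputable def shrinkingBump (n k : ℕ) : ContDiffBump (0 : EuclideanSpace ℝ (Fin n)) where
  rIn := 1 / ((k : ℝ) + 1) / 2
  rOut := 1 / ((k : ℝ) + 1)
  rIn_pos := by positivity
  rIn_lt_rOut := half_lt_self (by positivity)

/-- The `k`-th mollification of `f`. -/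
noncomputable def mollify (k : ℕ) (f : EuclideanSpace ℝ (Fin n) → F) :
    EuclideanSpace ℝ (Fin n) → F :=
  (shrinkingBump n k).normed volume ⋆[lsmul ℝ ℝ, volume] f

theorem tendsto_rOut_shrinkingBump :
    Tendsto (fun k => (shrinkingBump n k).rOut) atTop (𝓝 0) :=
  tendsto_one_div_add_atTop_nhds_zero_nat

theorem rOut_shrinkingBump_le (k : ℕ) : (shrinkingBump n k).rOut ≤ 1 := by
  change 1 / ((k : ℝ) + 1) ≤ 1
  rw [div_le_one (by positivity)]
  linarith [(Nat.cast_nonneg k : (0 : ℝ) ≤ k)]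

theorem mollify_apply (k : ℕ) (f : EuclideanSpace ℝ (Fin n) → F) (x : EuclideanSpace ℝ (Fin n)) :
    mollify k f x = ∫ t, (shrinkingBump n k).normed volume t • f (x - t) := rfl

theorem convolutionExists_mollify (k : ℕ) {f : EuclideanSpace ℝ (Fin n) → F}
    (hf : LocallyIntegrable f) :
    ConvolutionExists ((shrinkingBump n k).normed volume) f (lsmul ℝ ℝ) volume :=
  (shrinkingBump n k).hasCompactSupport_normed.convolutionExists_left _
    (shrinkingBump n k).continuous_normed hf

theorem mollify_add (k : ℕ) {f g : EuclideanSpace ℝ (Fin n) → F} (hf : LocallyIntegrable f)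
    (hg : LocallyIntegrable g) : mollify k (f + g) = mollify k f + mollify k g :=
  (convolutionExists_mollify k hf).distrib_add (convolutionExists_mollify k hg)

theorem contDiff_mollify [CompleteSpace F] (k : ℕ) {f : EuclideanSpace ℝ (Fin n) → F}
    (hf : LocallyIntegrable f) : ContDiff ℝ ∞ (mollify k f) :=
  (shrinkingBump n k).hasCompactSupport_normed.contDiff_convolution_left (n := (⊤ : ℕ∞)) _
    (shrinkingBump n k).contDiff_normed hf

theorem hasCompactSupport_mollify (k : ℕ) {f : EuclideanSpace ℝ (Fin n) → F}
    (hf : HasCompactSupport f) : HasCompactSupport (mollify k f) :=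
  (shrinkingBump n k).hasCompactSupport_normed.convolution _ hf

theorem dist_mollify_le [CompleteSpace F] (k : ℕ) {f : EuclideanSpace ℝ (Fin n) → F}
    (hf : Continuous f) {x : EuclideanSpace ℝ (Fin n)} {ε : ℝ}
    (h : ∀ y ∈ Metric.ball x (shrinkingBump n k).rOut, dist (f y) (f x) ≤ ε) :
    dist (mollify k f x) (f x) ≤ ε :=
  ContDiffBump.dist_normed_convolution_le hf.aestronglyMeasurable h

theorem tendstoUniformlyOn_mollify [CompleteSpace F] {f : EuclideanSpace ℝ (Fin n) → F}
    (hf : Continuous f) {S : Set (EuclideanSpace ℝ (Fin n))} (hS : IsCompact S) :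
    TendstoUniformlyOn (fun k => mollify k f) f atTop S := by
  rw [Metric.tendstoUniformlyOn_iff]
  intro ε hε
  have hu := hS.uniformContinuousAt_of_continuousAt f (fun a _ => hf.continuousAt)
    (Metric.dist_mem_uniformity (half_pos hε))
  obtain ⟨δ, hδ, hδ'⟩ := Metric.mem_uniformity_dist.1 hu
  filter_upwards [tendsto_rOut_shrinkingBump.eventually (gt_mem_nhds hδ)] with k hk x hx
  rw [dist_comm]
  refine (dist_mollify_le k hf fun y hy => ?_).trans_lt (half_lt_self hε)
  have := @hδ' x y (by rw [dist_comm]; exact (Metric.mem_ball.1 hy).trans hk) hx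
  rw [dist_comm]
  exact this.le

theorem tendstoUniformly_mollify [CompleteSpace F] {f : EuclideanSpace ℝ (Fin n) → F}
    (hf : Continuous f) (hfc : HasCompactSupport f) :
    TendstoUniformly (fun k => mollify k f) f atTop := by
  rw [Metric.tendstoUniformly_iff]
  intro ε hε
  obtain ⟨δ, hδ, hδ'⟩ := Metric.uniformContinuous_iff.1
    (hfc.uniformContinuous_of_continuous hf) (ε / 2) (half_pos hε)
  filter_upwards [tendsto_rOut_shrinkingBump.eventually (gt_mem_nhds hδ)] with k hk x
  rw [dist_comm]
  exact (dist_mollify_le k hf fun y hy => (hδ' ((Metric.mem_ball.1 hy).trans hk)).le).trans_lt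
    (half_lt_self hε)

theorem mollify_eq_zero (k : ℕ) {f : EuclideanSpace ℝ (Fin n) → F} {x : EuclideanSpace ℝ (Fin n)}
    (hx : x ∉ Metric.cthickening 1 (tsupport f)) : mollify k f x = 0 := by
  rw [mollify_apply, ← integral_zero (EuclideanSpace ℝ (Fin n)) F]
  congr 1
  funext t
  by_cases ht : t ∈ Metric.ball (0 : EuclideanSpace ℝ (Fin n)) (shrinkingBump n k).rOut
  · have : f (x - t) = 0 := by
      by_contra hne
      refine hx (Metric.mem_cthickening_of_dist_le x (x - t) 1 _
        (subset_tsupport f hne) ?_)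
      rw [dist_eq_norm, sub_sub_cancel]
      exact (mem_ball_zero_iff.1 ht).le.trans (rOut_shrinkingBump_le k)
    rw [this, smul_zero]
  · rw [← (shrinkingBump n k).support_normed_eq (μ := volume), Function.notMem_support] at ht
    rw [ht, zero_smul]

/-- The bump is a probability density, so the `L^1` norm against it is at most the `L^p` norm;
Tonelli and translation invariance finish. Strong measurability of `f` gives the joint measurability
that Tonelli needs. -/
theorem eLpNorm_mollify_le_of_stronglyMeasurable (k : ℕ) {p : ℝ} (hp : 1 ≤ p)
    {f : EuclideanSpace ℝ (Fin n) → F} (hf : StronglyMeasurable f) :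
    eLpNorm (mollify k f) (ENNReal.ofReal p) volume ≤ eLpNorm f (ENNReal.ofReal p) volume := by
  have hp0 : 0 < p := by linarith
  set ρ := (shrinkingBump n k).normed (volume : Measure (EuclideanSpace ℝ (Fin n))) with hρ
  have hρ0 : ∀ t, 0 ≤ ρ t := (shrinkingBump n k).nonneg_normed
  have hρm : Measurable fun t => ENNReal.ofReal (ρ t) :=
    (shrinkingBump n k).continuous_normed.measurable.ennreal_ofReal
  set ν := (volume : Measure (EuclideanSpace ℝ (Fin n))).withDensity fun t => ENNReal.ofReal (ρ t)
    with hν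
  have hprob : IsProbabilityMeasure ν := ⟨by
    rw [hν, withDensity_apply _ MeasurableSet.univ, Measure.restrict_univ,
      ← ofReal_integral_eq_lintegral_ofReal (shrinkingBump n k).integrable_normed
        (Eventually.of_forall hρ0), (shrinkingBump n k).integral_normed, ENNReal.ofReal_one]⟩
  have hfs : ∀ x, StronglyMeasurable fun t => f (x - t) := fun x =>
    hf.comp_measurable (measurable_const.sub measurable_id)
  have hpt : ∀ x, ‖mollify k f x‖ₑ ^ p ≤ ∫⁻ t, ‖f (x - t)‖ₑ ^ p ∂ν := fun x => by
    have h1 : ‖mollify k f x‖ₑ ≤ ∫⁻ t, ‖f (x - t)‖ₑ ∂ν := by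
      rw [mollify_apply]
      refine (enorm_integral_le_lintegral_enorm _).trans_eq ?_
      rw [lintegral_withDensity_eq_lintegral_mul _ hρm (hfs x).enorm]
      refine lintegral_congr fun t => ?_
      rw [enorm_smul, Real.enorm_of_nonneg (hρ0 t)]
      rfl
    have h2 := eLpNorm'_le_eLpNorm'_of_exponent_le one_pos hp ν (hfs x).aestronglyMeasurable
    simp only [eLpNorm', ENNReal.rpow_one, one_div, inv_one] at h2
    calc ‖mollify k f x‖ₑ ^ p ≤ ((∫⁻ t, ‖f (x - t)‖ₑ ^ p ∂ν) ^ p⁻¹) ^ p :=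
          ENNReal.rpow_le_rpow (h1.trans h2) hp0.le
      _ = _ := by rw [← ENNReal.rpow_mul, inv_mul_cancel₀ hp0.ne', ENNReal.rpow_one]
  rw [eLpNorm_eq_eLpNorm' (by simpa using hp0) ENNReal.ofReal_ne_top,
    eLpNorm_eq_eLpNorm' (by simpa using hp0) ENNReal.ofReal_ne_top, ENNReal.toReal_ofReal hp0.le]
  refine ENNReal.rpow_le_rpow ?_ (by positivity)
  calc ∫⁻ x, ‖mollify k f x‖ₑ ^ p ≤ ∫⁻ x, ∫⁻ t, ‖f (x - t)‖ₑ ^ p ∂ν := lintegral_mono hpt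
    _ = ∫⁻ t, (∫⁻ x, ‖f (x - t)‖ₑ ^ p) ∂ν := by
        refine lintegral_lintegral_swap (Measurable.aemeasurable ?_)
        exact (hf.comp_measurable (measurable_fst.sub measurable_snd)).enorm.pow_const p
    _ = ∫⁻ _, (∫⁻ x, ‖f x‖ₑ ^ p) ∂ν :=
        lintegral_congr fun t => lintegral_sub_right_eq_self (fun x => ‖f x‖ₑ ^ p) t
    _ = ∫⁻ x, ‖f x‖ₑ ^ p := by rw [lintegral_const, measure_univ, mul_one]

theorem eLpNorm_mollify_le (k : ℕ) {p : ℝ} (hp : 1 ≤ p)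
    {f : EuclideanSpace ℝ (Fin n) → F} (hf : AEStronglyMeasurable f) :
    eLpNorm (mollify k f) (ENNReal.ofReal p) volume ≤ eLpNorm f (ENNReal.ofReal p) volume := by
  have h : mollify k f = mollify k (hf.mk f) :=
    convolution_congr _ (ae_eq_refl _) hf.ae_eq_mk
  rw [h, eLpNorm_congr_ae hf.ae_eq_mk]
  exact eLpNorm_mollify_le_of_stronglyMeasurable k hp hf.stronglyMeasurable_mk

/-- Convergence is uniform, and as the bumps have radius at most `1` all differences live in one
compact set of finite measure. -/
theorem tendsto_eLpNorm_mollify_sub_of_continuous [CompleteSpace F] {p : ℝ}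
    {f : EuclideanSpace ℝ (Fin n) → F} (hf : Continuous f) (hfc : HasCompactSupport f) :
    Tendsto (fun k => eLpNorm (mollify k f - f) (ENNReal.ofReal p) volume) atTop (𝓝 0) := by
  set S := Metric.cthickening 1 (tsupport f)
  have hS : IsCompact S := hfc.isCompact.cthickening
  set M := (volume.restrict S Set.univ) ^ (ENNReal.ofReal p).toReal⁻¹ with hM
  have hMtop : M ≠ ⊤ := by
    rw [hM, Measure.restrict_apply_univ]
    exact ENNReal.rpow_ne_top_of_nonneg (by positivity) hS.measure_lt_top.ne
  refine ENNReal.tendsto_nhds_zero.2 fun ε hε => ?_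
  obtain ⟨r, hr, hrε⟩ : ∃ r : ℝ, 0 < r ∧ M * ENNReal.ofReal r ≤ ε := by
    have h : Tendsto (fun r : ℝ => M * ENNReal.ofReal r) (𝓝[>] 0) (𝓝 0) := by
      have := ENNReal.Tendsto.const_mul (a := M)
        ((ENNReal.continuous_ofReal.tendsto 0).mono_left (nhdsWithin_le_nhds (s := Set.Ioi 0)))
        (Or.inr hMtop)
      simpa using this
    obtain ⟨r, h1, h2⟩ := ((ENNReal.tendsto_nhds_zero.1 h ε hε).and self_mem_nhdsWithin).exists
    exact ⟨r, h2, h1⟩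
  filter_upwards [Metric.tendstoUniformly_iff.1 (tendstoUniformly_mollify hf hfc) r hr] with k hk
  rw [← eLpNorm_restrict_eq_of_support_subset (s := S)]
  · refine (eLpNorm_le_of_ae_bound (C := r) (Eventually.of_forall fun x => ?_)).trans hrε
    rw [Pi.sub_apply, ← dist_eq_norm, dist_comm]
    exact (hk x).le
  · intro x hx
    by_contra hxS
    refine hx ?_
    rw [Pi.sub_apply, mollify_eq_zero k hxS, image_eq_zero_of_notMem_tsupport fun h =>
      hxS (Metric.self_subset_cthickening _ h), sub_zero]

/-- Mollifications converge in `L^p`. -/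
theorem tendsto_eLpNorm_mollify_sub [CompleteSpace F] {p : ℝ} (hp : 1 ≤ p)
    {f : EuclideanSpace ℝ (Fin n) → F} (hf : MemLp f (ENNReal.ofReal p)) :
    Tendsto (fun k => eLpNorm (mollify k f - f) (ENNReal.ofReal p) volume) atTop (𝓝 0) := by
  have hp' : 1 ≤ ENNReal.ofReal p := by simpa using hp
  refine ENNReal.tendsto_nhds_zero.2 fun ε hε => ?_
  have hε3 : ε / 3 ≠ 0 := (ENNReal.div_pos hε.ne' (by simp)).ne'
  obtain ⟨g, hgc, hgε, hg, hgL⟩ :=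
    hf.exists_hasCompactSupport_eLpNorm_sub_le ENNReal.ofReal_ne_top hε3
  have hfg : MemLp (f - g) (ENNReal.ofReal p) := hf.sub hgL
  filter_upwards [ENNReal.tendsto_nhds_zero.1 (tendsto_eLpNorm_mollify_sub_of_continuous hg hgc)
    (ε / 3) (pos_iff_ne_zero.2 hε3)] with k hk
  -- Compare with a compactly supported continuous `g` near `f` in `L^p`; mollification does not
  -- enlarge the error `f - g`.
  have hadd : mollify k f = mollify k (f - g) + mollify k g := by
    rw [← mollify_add k (hfg.locallyIntegrable hp') (hgL.locallyIntegrable hp'), sub_add_cancel]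
  have e : mollify k f - f = mollify k (f - g) + (mollify k g - g) + (g - f) := by
    rw [hadd]; abel
  have m1 : AEStronglyMeasurable (mollify k (f - g)) volume :=
    (contDiff_mollify k (hfg.locallyIntegrable hp')).continuous.aestronglyMeasurable
  have m2 : AEStronglyMeasurable (mollify k g - g) volume :=
    ((contDiff_mollify k (hgL.locallyIntegrable hp')).continuous.sub hg).aestronglyMeasurable
  rw [e]
  calc _ ≤ eLpNorm (mollify k (f - g)) (ENNReal.ofReal p) volume +
        eLpNorm (mollify k g - g) (ENNReal.ofReal p) volume +
        eLpNorm (g - f) (ENNReal.ofReal p) volume :=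
        (eLpNorm_add_le (m1.add m2) (hgL.sub hf).1 hp').trans
          (add_le_add_left (eLpNorm_add_le m1 m2 hp') _)
    _ ≤ ε / 3 + ε / 3 + ε / 3 := by
        refine add_le_add (add_le_add ((eLpNorm_mollify_le k hp hfg.1).trans hgε) hk) ?_
        rwa [eLpNorm_sub_comm]
    _ = ε := ENNReal.add_thirds ε

/-- The gradient of a mollification is the mollification of the weak gradient. -/
theorem gradient_mollify (k : ℕ) {w : EuclideanSpace ℝ (Fin n) → ℝ}
    {H : EuclideanSpace ℝ (Fin n) → EuclideanSpace ℝ (Fin n)} (hw : LocallyIntegrable w)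
    (hwH : ∀ η : EuclideanSpace ℝ (Fin n) → ℝ, ContDiff ℝ ∞ η → HasCompactSupport η →
      ∫ x, w x • ∇ η x = -∫ x, η x • H x) :
    ∇ (mollify k w) = mollify k H := by
  funext x
  set ρ := (shrinkingBump n k).normed (volume : Measure (EuclideanSpace ℝ (Fin n))) with hρ
  have hρs : ContDiff ℝ ∞ ρ := (shrinkingBump n k).contDiff_normed (n := (⊤ : ℕ∞))
  have hρc : HasCompactSupport ρ := (shrinkingBump n k).hasCompactSupport_normed
  have hmw : mollify k w = w ⋆[lsmul ℝ ℝ, volume] ρ := by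
    funext z
    rw [mollify, convolution_lsmul_swap, convolution_lsmul]
    simp only [smul_eq_mul, mul_comm, hρ]
  have hηs : ContDiff ℝ ∞ fun t => ρ (x - t) := hρs.comp (contDiff_const.sub contDiff_id)
  have hηc : HasCompactSupport fun t => ρ (x - t) :=
    hρc.comp_homeomorph (Homeomorph.subLeft x)
  have hη : ∀ t, ∇ (fun t => ρ (x - t)) t = -∇ ρ (x - t) := fun t => by
    refine ext_inner_right ℝ fun v => ?_
    rw [inner_neg_left, inner_gradient_left, inner_gradient_left]
    have h := ((hρs.differentiable (by simp) (x - t)).hasFDerivAt.comp t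
      ((hasFDerivAt_id t).const_sub x))
    have h' : fderiv ℝ (fun t => ρ (x - t)) t = _ := h.fderiv
    rw [h']
    simp
  -- The sign from differentiating `t ↦ ρ (x - t)` cancels the sign in the weak gradient identity.
  have hkey := hwH _ hηs hηc
  simp only [hη, smul_neg, integral_neg, neg_inj] at hkey
  have hmH : mollify k H x = ∫ t, ρ (x - t) • H t := convolution_lsmul_swap
  rw [hmH, ← hkey, hmw]
  have hint : Integrable fun t => w t • ∇ ρ (x - t) := by
    have := hρc.gradient.convolutionExists_right (lsmul ℝ ℝ) (μ := volume) (f := w) hw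
      (hρs.of_le (by simp)).continuous_gradient x
    exact this
  refine ext_inner_right ℝ fun v => ?_
  rw [inner_gradient_left, (hρc.hasFDerivAt_convolution_right _ hw (hρs.of_le (by simp)) x).fderiv,
    convolution_precompR_apply _ hw (hρc.fderiv ℝ) (hρs.continuous_fderiv (by simp)),
    convolution_lsmul, real_inner_comm, ← integral_inner hint]
  refine integral_congr_ae (Eventually.of_forall fun t => ?_)
  simp only [inner_smul_right, smul_eq_mul]
  rw [real_inner_comm, inner_gradient_left]

/-- A mollification averages translates with nonnegative weights, and each translate is concave. -/
theorem ConcaveOn.mollify {K : EuclideanSpace ℝ (Fin n) → ℝ} (hK : ConcaveOn ℝ Set.univ K)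
    (hKc : Continuous K) (k : ℕ) : ConcaveOn ℝ Set.univ (mollify k K) := by
  refine ⟨convex_univ, fun x _ y _ a b ha hb hab => ?_⟩
  have hex := convolutionExists_mollify k hKc.locallyIntegrable
  have hi : ∀ z, Integrable fun t => (shrinkingBump n k).normed volume t • K (z - t) := hex
  simp only [mollify_apply, ← integral_smul]
  have hx := (hi x).fun_smul a
  have hy := (hi y).fun_smul b
  rw [← integral_add hx hy]
  refine integral_mono (hx.add hy) (hi _) fun t => ?_
  have h := hK.2 (Set.mem_univ (x - t)) (Set.mem_univ (y - t)) ha hb hab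
  have e : a • (x - t) + b • (y - t) = a • x + b • y - t := by
    have : t = (a + b) • t := by rw [hab, one_smul]
    nth_rw 3 [this]
    rw [smul_sub, smul_sub, add_smul]
    abel
  rw [e] at h
  have := mul_le_mul_of_nonneg_left h ((shrinkingBump n k).nonneg_normed (μ := volume) t)
  simp only [smul_eq_mul] at this ⊢
  linarith

end Mollify

/-! ### Hölder pairing of vector fields -/

section LpPairing

open Filter Topology

variable {n : ℕ} {p q : ℝ}

theorem integrable_inner_of_holderConjugate {α : Type*} [MeasurableSpace α] {μ : Measure α}
    (hpq : q.HolderConjugate p) {Φ Ψ : α → EuclideanSpace ℝ (Fin n)}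
    (hΦ : MemLp Φ (ENNReal.ofReal q) μ) (hΨ : MemLp Ψ (ENNReal.ofReal p) μ) :
    Integrable (fun x => inner ℝ (Φ x) (Ψ x)) μ := by
  have := hpq.ennrealOfReal
  rw [← memLp_one_iff_integrable]
  refine MemLp.of_bilin (p := ENNReal.ofReal q) (q := ENNReal.ofReal p)
    (fun a b => inner ℝ a b) 1 hΦ hΨ (hΦ.1.inner hΨ.1) (Eventually.of_forall fun x => ?_)
  rw [one_mul]
  exact nnnorm_inner_le_nnnorm _ _

theorem enorm_integral_inner_le {α : Type*} [MeasurableSpace α] {μ : Measure α}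
    (hpq : q.HolderConjugate p) {Φ Ψ : α → EuclideanSpace ℝ (Fin n)}
    (hΦ : AEStronglyMeasurable Φ μ) (hΨ : AEStronglyMeasurable Ψ μ) :
    ‖∫ x, inner ℝ (Φ x) (Ψ x) ∂μ‖ₑ ≤
      eLpNorm Φ (ENNReal.ofReal q) μ * eLpNorm Ψ (ENNReal.ofReal p) μ := by
  have := hpq.ennrealOfReal
  refine (enorm_integral_le_lintegral_enorm _).trans ?_
  rw [← eLpNorm_one_eq_lintegral_enorm]
  have h := eLpNorm_le_eLpNorm_mul_eLpNorm'_of_norm (p := ENNReal.ofReal q)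
    (q := ENNReal.ofReal p) (r := 1) hΦ hΨ (fun a b => inner ℝ a b) 1
    (Eventually.of_forall fun x => by
      simpa using norm_inner_le_norm (𝕜 := ℝ) (Φ x) (Ψ x))
  simpa using h

/-- Used with a fixed flux `Φ` and the gradients of varying test functions; by Hölder, `L^p`
convergence of the latter suffices. -/
theorem tendsto_integral_inner {α : Type*} [MeasurableSpace α] {μ : Measure α}
    (hpq : q.HolderConjugate p) {Φ Ψ : α → EuclideanSpace ℝ (Fin n)}
    {Ψk : ℕ → α → EuclideanSpace ℝ (Fin n)}
    (hΦ : MemLp Φ (ENNReal.ofReal q) μ) (hΨ : MemLp Ψ (ENNReal.ofReal p) μ)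
    (hΨk : ∀ k, MemLp (Ψk k) (ENNReal.ofReal p) μ)
    (hlim : Tendsto (fun k => eLpNorm (Ψk k - Ψ) (ENNReal.ofReal p) μ) atTop (𝓝 0)) :
    Tendsto (fun k => ∫ x, inner ℝ (Φ x) (Ψk k x) ∂μ) atTop (𝓝 (∫ x, inner ℝ (Φ x) (Ψ x) ∂μ)) := by
  rw [tendsto_iff_edist_tendsto_0]
  have h0 : Tendsto (fun k => eLpNorm Φ (ENNReal.ofReal q) μ *
      eLpNorm (Ψk k - Ψ) (ENNReal.ofReal p) μ) atTop (𝓝 0) := by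
    have := ENNReal.Tendsto.const_mul hlim (Or.inr hΦ.eLpNorm_ne_top)
    rwa [mul_zero] at this
  refine tendsto_of_tendsto_of_tendsto_of_le_of_le tendsto_const_nhds h0 (fun k => zero_le)
    fun k => ?_
  simp only
  rw [edist_eq_enorm_sub, ← integral_sub (integrable_inner_of_holderConjugate hpq hΦ (hΨk k))
    (integrable_inner_of_holderConjugate hpq hΦ hΨ)]
  simp_rw [← inner_sub_right]
  exact enorm_integral_inner_le hpq hΦ.1 ((hΨk k).sub hΨ).1

end LpPairing

/-! ### Chain rule by smooth approximation -/

section ChainRule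

open Filter Topology

variable {n : ℕ} {p q : ℝ}

theorem gradient_comp_smooth {ψ : ℝ → ℝ} (hψ : ContDiff ℝ ∞ ψ) {v : EuclideanSpace ℝ (Fin n) → ℝ}
    (hv : ContDiff ℝ ∞ v) (x : EuclideanSpace ℝ (Fin n)) :
    ∇ (fun z => ψ (v z)) x = deriv ψ (v x) • ∇ v x := by
  refine ext_inner_right ℝ fun a => ?_
  have h := (hψ.differentiable (by simp) (v x)).hasDerivAt.comp_hasFDerivAt x
    (hv.differentiable (by simp) x).hasFDerivAt
  have h' : fderiv ℝ (fun z => ψ (v z)) x = _ := h.fderiv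
  rw [inner_gradient_left, real_inner_smul_left, inner_gradient_left, h', smul_apply, smul_eq_mul]

/-- Approximate chain rule: the gradients of `ψ ∘ (ρ_k ⋆ w)` converge in `L^p` to `ψ'(w) H`. -/
theorem tendsto_eLpNorm_gradient_comp_mollify_sub (hp : 1 ≤ p)
    {w : EuclideanSpace ℝ (Fin n) → ℝ}
    {H : EuclideanSpace ℝ (Fin n) → EuclideanSpace ℝ (Fin n)} (hw : Continuous w)
    (hwc : HasCompactSupport w) (hH : MemLp H (ENNReal.ofReal p))
    (hwH : ∀ η : EuclideanSpace ℝ (Fin n) → ℝ, ContDiff ℝ ∞ η → HasCompactSupport η →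
      ∫ x, w x • ∇ η x = -∫ x, η x • H x) {ψ : ℝ → ℝ} (hψ : ContDiff ℝ ∞ ψ) :
    MemLp (fun x => deriv ψ (w x) • H x) (ENNReal.ofReal p) ∧
    Tendsto (fun k => eLpNorm (∇ (fun z => ψ (mollify k w z)) - fun x => deriv ψ (w x) • H x)
      (ENNReal.ofReal p) volume) atTop (𝓝 0) := by
  have hp' : 1 ≤ ENNReal.ofReal p := by simpa using hp
  have hψ' : Continuous (deriv ψ) := hψ.continuous_deriv (by simp)
  have hSc : IsCompact (Set.range w) := hwc.isCompact_range hw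
  obtain ⟨B, hB⟩ := hSc.exists_bound_of_continuousOn hψ'.continuousOn
  have hB' : ∀ x, ‖deriv ψ (w x)‖ ≤ B := fun x => hB _ ⟨x, rfl⟩
  have hB0 : 0 ≤ B := (norm_nonneg _).trans (hB' 0)
  have hunif : ∀ ε > 0, ∀ᶠ k in atTop, ∀ x, ‖deriv ψ (mollify k w x) - deriv ψ (w x)‖ ≤ ε :=
    fun ε hε => by
      obtain ⟨δ, hδ, hδ'⟩ := Metric.mem_uniformity_dist.1
        (hSc.uniformContinuousAt_of_continuousAt (deriv ψ) (fun a _ => hψ'.continuousAt)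
          (Metric.dist_mem_uniformity hε))
      filter_upwards [Metric.tendstoUniformly_iff.1 (tendstoUniformly_mollify hw hwc) δ hδ]
        with k hk x
      have := hδ' (hk x) ⟨x, rfl⟩
      rw [← dist_eq_norm, dist_comm]
      exact le_of_lt this
  have hmeas : AEStronglyMeasurable (fun x => deriv ψ (w x) • H x) volume :=
    (hψ'.comp hw).aestronglyMeasurable.smul hH.1
  have hLp : MemLp (fun x => deriv ψ (w x) • H x) (ENNReal.ofReal p) := by
    refine hH.of_le_mul hmeas (c := B) (Eventually.of_forall fun x => ?_)
    rw [norm_smul]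
    exact mul_le_mul_of_nonneg_right (hB' x) (norm_nonneg _)
  refine ⟨hLp, ?_⟩
  have hwl : LocallyIntegrable w := hw.locallyIntegrable
  have hHl := hH.locallyIntegrable hp'
  have hms : ∀ k, ContDiff ℝ ∞ (mollify k w) := fun k => contDiff_mollify k hwl
  have hmH : ∀ k, Continuous (mollify k H) := fun k => (contDiff_mollify k hHl).continuous
  -- The first summand is a bounded factor times an `L^p`-null sequence, the second a uniformly
  -- small factor times the fixed `H`. `B` bounds `ψ'` only on the range of `w`; for large `k` the
  -- mollified values are covered by `B + 1`.
  have hdecomp : ∀ k, (∇ (fun z => ψ (mollify k w z)) - fun x => deriv ψ (w x) • H x) =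
      (fun x => deriv ψ (mollify k w x) • (mollify k H x - H x)) +
        fun x => (deriv ψ (mollify k w x) - deriv ψ (w x)) • H x := fun k => by
    funext x
    rw [Pi.sub_apply, Pi.add_apply, gradient_comp_smooth hψ (hms k),
      gradient_mollify k hwl hwH, smul_sub, sub_smul]
    abel
  have hlim := tendsto_eLpNorm_mollify_sub hp hH
  refine ENNReal.tendsto_nhds_zero.2 fun ε hε => ?_
  have hε2 : 0 < ε / 2 := ENNReal.half_pos hε.ne'
  have hl1 : Tendsto (fun k => ENNReal.ofReal (B + 1) *
      eLpNorm (mollify k H - H) (ENNReal.ofReal p) volume) atTop (𝓝 0) := by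
    have := ENNReal.Tendsto.const_mul (a := ENNReal.ofReal (B + 1)) hlim
      (Or.inr ENNReal.ofReal_ne_top)
    rwa [mul_zero] at this
  obtain ⟨r, hr, hrε⟩ : ∃ r : ℝ, 0 < r ∧
      ENNReal.ofReal r * eLpNorm H (ENNReal.ofReal p) volume ≤ ε / 2 := by
    have h : Tendsto (fun r : ℝ => ENNReal.ofReal r * eLpNorm H (ENNReal.ofReal p) volume)
        (𝓝[>] 0) (𝓝 0) := by
      have := ENNReal.Tendsto.mul_const (b := eLpNorm H (ENNReal.ofReal p) volume)
        ((ENNReal.continuous_ofReal.tendsto 0).mono_left (nhdsWithin_le_nhds (s := Set.Ioi 0)))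
        (Or.inr hH.eLpNorm_ne_top)
      simpa using this
    obtain ⟨r, h1, h2⟩ := ((ENNReal.tendsto_nhds_zero.1 h _ hε2).and self_mem_nhdsWithin).exists
    exact ⟨r, h2, h1⟩
  filter_upwards [hunif 1 one_pos, hunif r hr, ENNReal.tendsto_nhds_zero.1 hl1 _ hε2]
    with k h1 h2 h3
  have hc : Continuous fun x => deriv ψ (mollify k w x) := hψ'.comp (hms k).continuous
  rw [hdecomp k]
  refine (eLpNorm_add_le (hc.aestronglyMeasurable.smul ((hmH k).aestronglyMeasurable.sub hH.1))
    ((hc.sub (hψ'.comp hw)).aestronglyMeasurable.smul hH.1) hp').trans ?_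
  rw [← ENNReal.add_halves ε]
  refine add_le_add (le_trans ?_ h3) (le_trans ?_ hrε)
  · refine eLpNorm_le_mul_eLpNorm_of_ae_le_mul (Eventually.of_forall fun x => ?_) _
    change ‖deriv ψ (mollify k w x) • (mollify k H x - H x)‖ ≤ (B + 1) * ‖mollify k H x - H x‖
    rw [norm_smul]
    refine mul_le_mul_of_nonneg_right ?_ (norm_nonneg _)
    have := norm_le_norm_add_norm_sub' (deriv ψ (mollify k w x)) (deriv ψ (w x))
    linarith [h1 x, hB' x]
  · refine eLpNorm_le_mul_eLpNorm_of_ae_le_mul (Eventually.of_forall fun x => ?_) _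
    change ‖(deriv ψ (mollify k w x) - deriv ψ (w x)) • H x‖ ≤ r * ‖H x‖
    rw [norm_smul]
    exact mul_le_mul_of_nonneg_right (h2 x) (norm_nonneg _)

end ChainRule

/-! ### Weak gradients: smooth perturbations and cutoffs -/

section WeakGradient

open Filter Topology

variable {n : ℕ} {p : ℝ}

theorem tsupport_gradient_subset (f : EuclideanSpace ℝ (Fin n) → ℝ) :
    tsupport (∇ f) ⊆ tsupport f :=
  closure_minimal (fun x hx => by
    by_contra hx'
    exact hx (gradient_eq_zero_of_notMem_tsupport hx')) (isClosed_tsupport f)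

theorem gradient_mul {f g : EuclideanSpace ℝ (Fin n) → ℝ} {x : EuclideanSpace ℝ (Fin n)}
    (hf : DifferentiableAt ℝ f x) (hg : DifferentiableAt ℝ g x) :
    ∇ (fun z => f z * g z) x = f x • ∇ g x + g x • ∇ f x := by
  refine ext_inner_right ℝ fun a => ?_
  rw [inner_gradient_left, inner_add_left, real_inner_smul_left, real_inner_smul_left,
    inner_gradient_left, inner_gradient_left, fderiv_fun_mul hf hg]
  simp

theorem integral_smul_gradient_eq_neg {f φ : EuclideanSpace ℝ (Fin n) → ℝ}
    (hf : ContDiff ℝ 1 f) (hφ : ContDiff ℝ 1 φ) (hφc : HasCompactSupport φ) :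
    ∫ x, f x • ∇ φ x = -∫ x, φ x • ∇ f x := by
  have h1 : Integrable fun x => f x • ∇ φ x :=
    (hf.continuous.smul hφ.continuous_gradient).integrable_of_hasCompactSupport
      hφc.gradient.smul_left
  have h2 : Integrable fun x => φ x • ∇ f x :=
    (hφ.continuous.smul hf.continuous_gradient).integrable_of_hasCompactSupport
      hφc.smul_right
  refine ext_inner_left ℝ fun v => ?_
  rw [inner_neg_right, ← integral_inner h1, ← integral_inner h2]
  have hin : ∀ (g : EuclideanSpace ℝ (Fin n) → ℝ) x, inner ℝ v (∇ g x) = fderiv ℝ g x v :=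
    fun g x => by rw [real_inner_comm, inner_gradient_left]
  simp_rw [inner_smul_right, hin]
  have hf' : Continuous fun x => fderiv ℝ f x v :=
    (hf.continuous_fderiv one_ne_zero).clm_apply continuous_const
  have hφ' : Continuous fun x => fderiv ℝ φ x v :=
    (hφ.continuous_fderiv one_ne_zero).clm_apply continuous_const
  rw [integral_mul_fderiv_eq_neg_fderiv_mul_of_integrable
    ((hf'.mul hφ.continuous).integrable_of_hasCompactSupport hφc.mul_left)
    ((hf.continuous.mul hφ').integrable_of_hasCompactSupport (hφc.fderiv_apply ℝ v).mul_left)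
    ((hf.continuous.mul hφ.continuous).integrable_of_hasCompactSupport hφc.mul_left)
    (fun x _ => hf.differentiable one_ne_zero x) (fun x _ => hφ.differentiable one_ne_zero x)]
  simp_rw [mul_comm]

theorem MemLpLoc.of_continuous {F : Type*} [NormedAddCommGroup F] [SecondCountableTopology F]
    {D : Set (EuclideanSpace ℝ (Fin n))} {f : EuclideanSpace ℝ (Fin n) → F} (hf : Continuous f) :
    MemLpLoc p D f := fun C hC _ => by
  obtain ⟨B, hB⟩ := hC.exists_bound_of_continuousOn hf.continuousOn
  have : IsFiniteMeasure (volume.restrict C) := ⟨by simpa using hC.measure_lt_top⟩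
  exact MemLp.of_bound hf.aestronglyMeasurable B
    ((ae_restrict_iff' hC.measurableSet).2 (Eventually.of_forall hB))

theorem MemLpLoc.integrable_smul {F : Type*} [NormedAddCommGroup F] [NormedSpace ℝ F]
    {D : Set (EuclideanSpace ℝ (Fin n))} {f : EuclideanSpace ℝ (Fin n) → F} (hp : 1 ≤ p)
    (hf : MemLpLoc p D f) {g : EuclideanSpace ℝ (Fin n) → ℝ} (hg : Continuous g)
    (hgc : HasCompactSupport g) (hgD : tsupport g ⊆ D) : Integrable fun x => g x • f x := by
  obtain ⟨B, hB⟩ := hg.bounded_above_of_compact_support hgc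
  have hfi : IntegrableOn f (tsupport g) := by
    have : IsFiniteMeasure (volume.restrict (tsupport g)) :=
      ⟨by simpa using hgc.isCompact.measure_lt_top⟩
    exact (hf _ hgc.isCompact hgD).integrable (by simpa using hp)
  have h : IntegrableOn (fun x => g x • f x) (tsupport g) :=
    hfi.bdd_smul B hg.aestronglyMeasurable (Eventually.of_forall hB)
  refine (integrableOn_iff_integrable_of_support_subset fun x hx => ?_).1 h
  refine subset_tsupport g fun h0 => hx ?_
  simp only [h0, zero_smul]

/-- `f` may be arbitrary outside `D`, but near each point off the support of `g` the product is
zero. -/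
theorem integrable_smul_of_continuousOn {F : Type*} [NormedAddCommGroup F] [NormedSpace ℝ F]
    {D : Set (EuclideanSpace ℝ (Fin n))} (hD : IsOpen D) {f : EuclideanSpace ℝ (Fin n) → ℝ}
    (hf : ContinuousOn f D) {g : EuclideanSpace ℝ (Fin n) → F} (hg : Continuous g)
    (hgc : HasCompactSupport g) (hgD : tsupport g ⊆ D) :
    Continuous (fun x => f x • g x) ∧ Integrable fun x => f x • g x := by
  have hc : Continuous fun x => f x • g x := by
    refine continuous_iff_continuousAt.2 fun x => ?_
    by_cases hx : x ∈ tsupport g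
    · exact ((hf.continuousAt (hD.mem_nhds (hgD hx)))).smul hg.continuousAt
    · have : (fun x => f x • g x) =ᶠ[𝓝 x] fun _ => 0 := by
        filter_upwards [notMem_tsupport_iff_eventuallyEq.1 hx] with z hz
        rw [hz, Pi.zero_apply, smul_zero]
      exact continuousAt_const.congr this.symm
  exact ⟨hc, hc.integrable_of_hasCompactSupport hgc.smul_left⟩

/-- Subtracting a smooth function and a constant from a function with weak gradient. -/
theorem HasWeakGradientLp.sub_smooth {D : Set (EuclideanSpace ℝ (Fin n))} (hD : IsOpen D)
    (hp : 1 ≤ p) {h : EuclideanSpace ℝ (Fin n) → ℝ}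
    {G : EuclideanSpace ℝ (Fin n) → EuclideanSpace ℝ (Fin n)} (hG : HasWeakGradientLp p D h G)
    (hc : ContinuousOn h D) {V : EuclideanSpace ℝ (Fin n) → ℝ} (hV : ContDiff ℝ 1 V) :
    HasWeakGradientLp p D (fun x => h x - V x) (fun x => G x - ∇ V x) where
  memLpLoc C hC hCD := (hG.memLpLoc C hC hCD).sub (MemLpLoc.of_continuous hV.continuous C hC hCD)
  memLpLoc_grad C hC hCD :=
    (hG.memLpLoc_grad C hC hCD).sub (MemLpLoc.of_continuous hV.continuous_gradient C hC hCD)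
  integral_eq φ hφ := by
    obtain ⟨hφs, hφc, hφD⟩ := hφ
    have hφ1 : ContDiff ℝ 1 φ := hφs.of_le (by simp)
    have hgD : tsupport (∇ φ) ⊆ D := (tsupport_gradient_subset φ).trans hφD
    have i1 := (integrable_smul_of_continuousOn hD hc hφ1.continuous_gradient hφc.gradient hgD).2
    have i2 := (integrable_smul_of_continuousOn hD hV.continuous.continuousOn
      hφ1.continuous_gradient hφc.gradient hgD).2
    have i3 := hG.memLpLoc_grad.integrable_smul hp hφs.continuous hφc hφD
    have i4 := (MemLpLoc.of_continuous (p := p) (D := D) hV.continuous_gradient).integrable_smul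
      hp hφs.continuous hφc hφD
    simp only [sub_smul, smul_sub]
    rw [integral_sub i1 i2, integral_sub i3 i4, hG.integral_eq φ ⟨hφs, hφc, hφD⟩,
      integral_smul_gradient_eq_neg hV hφ1 hφc]
    abel

/-- The field is the Leibniz gradient of `χ u`. The cutoff turns local integrability in `D` into
global integrability, as mollification on the whole space requires. -/
theorem HasWeakGradientLp.memLp_cutoff {D : Set (EuclideanSpace ℝ (Fin n))} (hD : IsOpen D)
    {u : EuclideanSpace ℝ (Fin n) → ℝ}
    {Γ : EuclideanSpace ℝ (Fin n) → EuclideanSpace ℝ (Fin n)} (hΓ : HasWeakGradientLp p D u Γ)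
    (hu : ContinuousOn u D) {χ : EuclideanSpace ℝ (Fin n) → ℝ} (hχ : ContDiff ℝ ∞ χ)
    (hχc : HasCompactSupport χ) (hχD : tsupport χ ⊆ D) :
    MemLp (fun x => χ x • Γ x + u x • ∇ χ x) (ENNReal.ofReal p) := by
  have hχ1 : ContDiff ℝ 1 χ := hχ.of_le (by simp)
  have hgD : tsupport (∇ χ) ⊆ D := (tsupport_gradient_subset χ).trans hχD
  have c1 : Continuous fun x => u x • ∇ χ x :=
    (integrable_smul_of_continuousOn hD hu hχ1.continuous_gradient hχc.gradient hgD).1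
  have c2 : HasCompactSupport fun x => u x • ∇ χ x := HasCompactSupport.intro hχc fun x hx => by
    rw [gradient_eq_zero_of_notMem_tsupport hx, smul_zero]
  have m2 : MemLp (fun x => u x • ∇ χ x) (ENNReal.ofReal p) :=
    c1.memLp_of_hasCompactSupport c2
  obtain ⟨B, hB⟩ := hχ.continuous.bounded_above_of_compact_support hχc
  have hS := hΓ.memLpLoc_grad _ hχc.isCompact hχD
  have hm : AEStronglyMeasurable (fun x => χ x • Γ x) (volume.restrict (tsupport χ)) :=
    hχ.continuous.aestronglyMeasurable.smul hS.1
  have hle : ∀ x, ‖χ x • Γ x‖ ≤ B * ‖Γ x‖ := fun x => by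
    rw [norm_smul]
    exact mul_le_mul_of_nonneg_right (hB x) (norm_nonneg _)
  have h1 : MemLp (fun x => χ x • Γ x) (ENNReal.ofReal p) (volume.restrict (tsupport χ)) :=
    hS.of_le_mul hm (Eventually.of_forall hle)
  rw [← memLp_indicator_iff_restrict (isClosed_tsupport χ).measurableSet] at h1
  have e : (tsupport χ).indicator (fun x => χ x • Γ x) = fun x => χ x • Γ x := by
    refine Set.indicator_eq_self.2 fun x hx => subset_tsupport χ fun h0 => hx ?_
    simp only [h0, zero_smul]
  rw [e] at h1
  exact h1.add m2

/-- The Leibniz rule for a cutoff times a function with a weak gradient. -/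
theorem HasWeakGradientLp.integral_cutoff {D : Set (EuclideanSpace ℝ (Fin n))} (hD : IsOpen D)
    (hp : 1 ≤ p) {u : EuclideanSpace ℝ (Fin n) → ℝ}
    {Γ : EuclideanSpace ℝ (Fin n) → EuclideanSpace ℝ (Fin n)} (hΓ : HasWeakGradientLp p D u Γ)
    (hu : ContinuousOn u D) {χ : EuclideanSpace ℝ (Fin n) → ℝ} (hχ : ContDiff ℝ ∞ χ)
    (hχc : HasCompactSupport χ) (hχD : tsupport χ ⊆ D)
    (η : EuclideanSpace ℝ (Fin n) → ℝ) (hη : ContDiff ℝ ∞ η) (hηc : HasCompactSupport η) :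
    ∫ x, (u x * χ x) • ∇ η x = -∫ x, η x • (χ x • Γ x + u x • ∇ χ x) := by
  have hχ1 : ContDiff ℝ 1 χ := hχ.of_le (by simp)
  have hη1 : ContDiff ℝ 1 η := hη.of_le (by simp)
  -- `η` need not be supported in `D`, but `χ η` is, so it is admissible for `u`.
  have htest : IsTestFunction D fun x => χ x * η x :=
    ⟨hχ.mul hη, hηc.mul_left, (tsupport_mul_subset_left).trans hχD⟩
  have hgr : ∀ x, ∇ (fun x => χ x * η x) x = χ x • ∇ η x + η x • ∇ χ x := fun x =>
    gradient_mul (hχ1.differentiable one_ne_zero x) (hη1.differentiable one_ne_zero x)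
  have key := hΓ.integral_eq _ htest
  simp only [hgr, smul_add] at key
  have i1 : Integrable fun x => u x • χ x • ∇ η x :=
    (integrable_smul_of_continuousOn hD hu (hχ.continuous.smul hη1.continuous_gradient)
      hχc.smul_right ((closure_mono fun x hx => by
        rw [Function.mem_support] at hx ⊢
        exact fun h0 => hx (by rw [Pi.smul_apply', h0, zero_smul])).trans hχD)).2
  have i2 : Integrable fun x => u x • η x • ∇ χ x :=
    (integrable_smul_of_continuousOn hD hu (hη.continuous.smul hχ1.continuous_gradient)
      hηc.smul_right ((closure_minimal (fun x hx => by
        by_contra hx'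
        refine hx ?_
        rw [Pi.smul_apply', gradient_eq_zero_of_notMem_tsupport hx', smul_zero])
        (isClosed_tsupport χ)).trans hχD)).2
  have i3 : Integrable fun x => (χ x * η x) • Γ x :=
    hΓ.memLpLoc_grad.integrable_smul hp htest.1.continuous htest.2.1 htest.2.2
  rw [integral_add i1 i2] at key
  have e1 : (fun x => (u x * χ x) • ∇ η x) = fun x => u x • χ x • ∇ η x := by
    funext x; rw [mul_smul]
  have e2 : (fun x => η x • (χ x • Γ x + u x • ∇ χ x)) =
      fun x => (χ x * η x) • Γ x + u x • η x • ∇ χ x := by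
    funext x
    rw [smul_add, smul_smul, mul_comm, smul_comm (η x) (u x)]
  rw [e1, e2, integral_add i3 i2, eq_sub_of_add_eq key]
  abel

end WeakGradient

/-! ### Monotonicity and integrability of the flux `|a|^(p-2) a` -/

section Flux

variable {n : ℕ} {p q : ℝ}

/-- For `r ≥ 0` both summands are nonnegative, the second because powers are monotone; this gives
monotonicity of the flux, and strict monotonicity when `r > 0`. -/
theorem inner_rpow_norm_smul_sub (r : ℝ) (a b : EuclideanSpace ℝ (Fin n)) :
    inner ℝ (‖a‖ ^ r • a - ‖b‖ ^ r • b) (a - b) =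
      1 / 2 * (‖a‖ ^ r + ‖b‖ ^ r) * ‖a - b‖ ^ 2 +
      1 / 2 * ((‖a‖ ^ r - ‖b‖ ^ r) * (‖a‖ ^ 2 - ‖b‖ ^ 2)) := by
  rw [norm_sub_sq_real]
  simp only [inner_sub_left, inner_sub_right, real_inner_smul_left, real_inner_self_eq_norm_sq,
    real_inner_comm a b]
  ring

theorem rpow_sub_mul_sq_sub_nonneg {r s t : ℝ} (hr : 0 ≤ r) (hs : 0 ≤ s) (ht : 0 ≤ t) :
    0 ≤ (s ^ r - t ^ r) * (s ^ 2 - t ^ 2) := by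
  rcases le_total s t with h | h
  · exact mul_nonneg_of_nonpos_of_nonpos (sub_nonpos.2 (Real.rpow_le_rpow hs h hr))
      (sub_nonpos.2 (pow_le_pow_left₀ hs h 2))
  · exact mul_nonneg (sub_nonneg.2 (Real.rpow_le_rpow ht h hr))
      (sub_nonneg.2 (pow_le_pow_left₀ ht h 2))

theorem inner_rpow_norm_smul_sub_nonneg {r : ℝ} (hr : 0 ≤ r) (a b : EuclideanSpace ℝ (Fin n)) :
    0 ≤ inner ℝ (‖a‖ ^ r • a - ‖b‖ ^ r • b) (a - b) := by
  rw [inner_rpow_norm_smul_sub]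
  have := rpow_sub_mul_sq_sub_nonneg hr (norm_nonneg a) (norm_nonneg b)
  positivity

theorem eq_of_inner_rpow_norm_smul_sub_eq_zero {r : ℝ} (hr : 0 < r)
    {a b : EuclideanSpace ℝ (Fin n)}
    (h : inner ℝ (‖a‖ ^ r • a - ‖b‖ ^ r • b) (a - b) = 0) : a = b := by
  rw [inner_rpow_norm_smul_sub] at h
  have h1 := rpow_sub_mul_sq_sub_nonneg hr.le (norm_nonneg a) (norm_nonneg b)
  have ha := Real.rpow_nonneg (norm_nonneg a) r
  have hb := Real.rpow_nonneg (norm_nonneg b) r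
  have h2 : 0 ≤ 1 / 2 * (‖a‖ ^ r + ‖b‖ ^ r) * ‖a - b‖ ^ 2 := by positivity
  have h3 : (‖a‖ ^ r + ‖b‖ ^ r) * ‖a - b‖ ^ 2 = 0 := by linarith
  rcases mul_eq_zero.1 h3 with h4 | h4
  · have ha0 : ‖a‖ ^ r = 0 := by linarith
    have hb0 : ‖b‖ ^ r = 0 := by linarith
    rw [Real.rpow_eq_zero (norm_nonneg _) hr.ne', norm_eq_zero] at ha0 hb0
    rw [ha0, hb0]
  · rwa [sq_eq_zero_iff, norm_eq_zero, sub_eq_zero] at h4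

theorem memLp_rpow_norm_smul {α : Type*} [MeasurableSpace α] {μ : Measure α} (hp : 2 < p)
    {f : α → EuclideanSpace ℝ (Fin n)} (hf : MemLp f (ENNReal.ofReal p) μ) :
    MemLp (fun x => ‖f x‖ ^ (p - 2) • f x) (ENNReal.ofReal (p / (p - 1))) μ := by
  have hp1 : 0 < p - 1 := by linarith
  have h := hf.norm_rpow_div (ENNReal.ofReal (p - 1))
  rw [← ENNReal.ofReal_div_of_pos hp1, ENNReal.toReal_ofReal hp1.le] at h
  have hm : AEStronglyMeasurable (fun x => ‖f x‖ ^ (p - 2) • f x) μ :=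
    (hf.1.norm.aemeasurable.pow_const _).aestronglyMeasurable.smul hf.1
  refine h.of_le hm (Filter.Eventually.of_forall fun x => ?_)
  rw [norm_smul, Real.norm_of_nonneg (Real.rpow_nonneg (norm_nonneg _) _),
    Real.norm_of_nonneg (Real.rpow_nonneg (norm_nonneg _) _)]
  rcases eq_or_ne ‖f x‖ 0 with h0 | h0
  · rw [h0, mul_zero]
    exact Real.rpow_nonneg le_rfl _
  · rw [← Real.rpow_add_one h0]
    exact le_of_eq (by ring_nf)

/-- Recovers the integral of a test function from its gradient, playing the part of a Poincaré
inequality. -/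
theorem integral_inner_basis_mul_fderiv (i : Fin n) {φ : EuclideanSpace ℝ (Fin n) → ℝ}
    (hφ : ContDiff ℝ 1 φ) (hφc : HasCompactSupport φ) :
    ∫ x, x i * fderiv ℝ φ x (EuclideanSpace.basisFun (Fin n) ℝ i) = -∫ x, φ x := by
  have hd : ∀ x : EuclideanSpace ℝ (Fin n), HasFDerivAt (fun x : EuclideanSpace ℝ (Fin n) => x i)
      (EuclideanSpace.proj i : EuclideanSpace ℝ (Fin n) →L[ℝ] ℝ) x := fun x =>
    (EuclideanSpace.proj i : EuclideanSpace ℝ (Fin n) →L[ℝ] ℝ).hasFDerivAt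
  have hd' : ∀ x : EuclideanSpace ℝ (Fin n), fderiv ℝ (fun x : EuclideanSpace ℝ (Fin n) => x i) x
      (EuclideanSpace.basisFun (Fin n) ℝ i) = 1 := fun x => by
    rw [(hd x).fderiv]
    simp
  have hc : Continuous fun x : EuclideanSpace ℝ (Fin n) => x i :=
    (EuclideanSpace.proj i : EuclideanSpace ℝ (Fin n) →L[ℝ] ℝ).continuous
  have hφ' : Continuous fun x => fderiv ℝ φ x (EuclideanSpace.basisFun (Fin n) ℝ i) :=
    (hφ.continuous_fderiv one_ne_zero).clm_apply continuous_const
  rw [integral_mul_fderiv_eq_neg_fderiv_mul_of_integrable]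
  · simp_rw [hd', one_mul]
  · simp_rw [hd', one_mul]
    exact hφ.continuous.integrable_of_hasCompactSupport hφc
  · exact (hc.mul hφ').integrable_of_hasCompactSupport (hφc.fderiv_apply ℝ _).mul_left
  · exact (hc.mul hφ.continuous).integrable_of_hasCompactSupport hφc.mul_left
  · exact fun x _ => (hd x).differentiableAt
  · exact fun x _ => hφ.differentiable one_ne_zero x

end Flux

/-! ### Comparison with smooth dominative supersolutions -/

section Comparison

open Filter Topology

variable {n : ℕ} {p : ℝ}

/-- Being `1` near `C`, and not merely on it, makes the gradient of `χ` vanish on `C`. -/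
theorem exists_smooth_cutoff {C D : Set (EuclideanSpace ℝ (Fin n))} (hC : IsCompact C)
    (hD : IsOpen D) (hCD : C ⊆ D) :
    ∃ χ : EuclideanSpace ℝ (Fin n) → ℝ, ContDiff ℝ ∞ χ ∧ HasCompactSupport χ ∧ tsupport χ ⊆ D ∧
      (∀ x, 0 ≤ χ x) ∧ ∀ x ∈ C, χ =ᶠ[𝓝 x] fun _ => 1 := by
  obtain ⟨T, hT, hCT, hTD⟩ := exists_compact_between hC hD hCD
  obtain ⟨f, hf1, hf0, hf⟩ := exists_contMDiffMap_one_nhds_of_subset_interior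
    (modelWithCornersSelf ℝ (EuclideanSpace ℝ (Fin n))) (n := (⊤ : ℕ∞)) hC.isClosed hCT
  have hts : tsupport f ⊆ T := closure_minimal (fun x hx => by
    by_contra hxT
    exact hx (hf0 x hxT)) hT.isClosed
  exact ⟨f, f.contMDiff.contDiff, HasCompactSupport.intro hT hf0, hts.trans hTD,
    fun x => (hf x).1, fun x hx => (eventually_nhdsSet_iff_forall.1 hf1) x hx⟩

/-- The truncation `t ↦ exp(-1/(t-c))` for `t > c`, zero for `t ≤ c`. -/
noncomputable def smoothTruncation (c t : ℝ) : ℝ := expNegInvGlue (t - c)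

theorem contDiff_smoothTruncation (c : ℝ) : ContDiff ℝ ∞ (smoothTruncation c) :=
  (expNegInvGlue.contDiff (n := (⊤ : ℕ∞))).comp (contDiff_id.sub contDiff_const)

theorem smoothTruncation_eq_zero {c t : ℝ} (h : t ≤ c) : smoothTruncation c t = 0 :=
  expNegInvGlue.zero_of_nonpos (sub_nonpos.2 h)

theorem smoothTruncation_pos {c t : ℝ} (h : c < t) : 0 < smoothTruncation c t :=
  expNegInvGlue.pos_of_pos (sub_pos.2 h)

theorem smoothTruncation_nonneg (c t : ℝ) : 0 ≤ smoothTruncation c t := expNegInvGlue.nonneg _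

theorem smoothTruncation_le_one (c t : ℝ) : smoothTruncation c t ≤ 1 := by
  rcases le_or_gt t c with h | h
  · rw [smoothTruncation_eq_zero h]
    exact zero_le_one
  · have h' : 0 < t - c := sub_pos.2 h
    rw [smoothTruncation, expNegInvGlue, if_neg h'.not_ge]
    exact Real.exp_le_one_iff.2 (neg_nonpos.2 (inv_nonneg.2 h'.le))

theorem deriv_smoothTruncation_nonneg (c t : ℝ) : 0 ≤ deriv (smoothTruncation c) t :=
  Monotone.deriv_nonneg fun _ _ h => expNegInvGlue.monotone (sub_le_sub_right h c)

theorem deriv_smoothTruncation_eq_zero {c t : ℝ} (h : t < c) :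
    deriv (smoothTruncation c) t = 0 := by
  have : smoothTruncation c =ᶠ[𝓝 t] fun _ => 0 := by
    filter_upwards [gt_mem_nhds h] with s hs
    exact smoothTruncation_eq_zero (le_of_lt hs)
  rw [this.deriv_eq, deriv_const]

set_option maxHeartbeats 1000000 in
/-- Comparison of a `p`-harmonic function with a smooth dominative supersolution. -/
theorem IsPHarmonicOn.le_of_le_frontier (hn : 1 ≤ n) (hp : 2 < p)
    {D : Set (EuclideanSpace ℝ (Fin n))} (hD : IsOpen D) (hDc : IsCompact (closure D))
    {h : EuclideanSpace ℝ (Fin n) → ℝ} (hc : ContinuousOn h (closure D))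
    (hh : IsPHarmonicOn p D h) {U : EuclideanSpace ℝ (Fin n) → ℝ} (hU : IsDominativeSuper p U)
    (hb : ∀ x ∈ frontier D, h x ≤ U x) {x₀ : EuclideanSpace ℝ (Fin n)} (hx₀ : x₀ ∈ D) :
    h x₀ ≤ U x₀ := by
  by_contra! hlt
  obtain ⟨hhc, G, hG, hGh⟩ := hh
  -- The excess `3c` at `x₀` is spent in three parts: `c` keeps the contact set off the boundary,
  -- `c` absorbs the mollification error, and `c` keeps the truncation positive at `x₀`.
  set c := (h x₀ - U x₀) / 3 with hcdef
  have hc0 : 0 < c := by rw [hcdef]; linarith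
  have hp1 : 1 ≤ p := by linarith
  have hUs := hU.contDiff
  have hgU : Continuous (∇ U) := (hUs.of_le (by simp)).continuous_gradient
  -- the contact region
  set C := closure D ∩ (fun x => h x - U x) ⁻¹' Set.Ici c with hC
  have hCc : IsCompact C := by
    have : IsClosed C :=
      (hc.sub hUs.continuous.continuousOn).preimage_isClosed_of_isClosed isClosed_closure isClosed_Ici
    exact hDc.of_isClosed_subset this Set.inter_subset_left
  have hCD : C ⊆ D := fun x hx => by
    by_contra hxD
    have hfr : x ∈ frontier D := by rw [frontier, hD.interior_eq]; exact ⟨hx.1, hxD⟩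
    have h1 := hb x hfr
    have h2 : c ≤ h x - U x := hx.2
    linarith
  obtain ⟨χ, hχ, hχc, hχD, hχ0, hχ1⟩ := exists_smooth_cutoff hCc hD hCD
  -- the truncated difference and its weak gradient
  set V := fun x => U x + c with hV
  have hVs : ContDiff ℝ 1 V := (hUs.of_le (by simp)).add contDiff_const
  have hgV : ∀ x, ∇ V x = ∇ U x := fun x => by
    simp only [gradient, hV, fderiv_add_const]
  set u := fun x => h x - V x with hu
  have huc : ContinuousOn u D := hhc.sub hVs.continuous.continuousOn
  have hΓ : HasWeakGradientLp p D u (fun x => G x - ∇ V x) := hG.sub_smooth hD hp1 hhc hVs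
  set w := fun x => u x * χ x with hw
  have hwc : Continuous w :=
    (integrable_smul_of_continuousOn hD huc hχ.continuous hχc hχD).1
  have hwcs : HasCompactSupport w := HasCompactSupport.intro hχc fun x hx => by
    simp only [hw, image_eq_zero_of_notMem_tsupport hx, mul_zero]
  set H := fun x => χ x • (G x - ∇ V x) + u x • ∇ χ x with hH
  have hHL : MemLp H (ENNReal.ofReal p) := hΓ.memLp_cutoff hD huc hχ hχc hχD
  have hwH := hΓ.integral_cutoff hD hp1 huc hχ hχc hχD
  have hHC : ∀ x ∈ C, H x = G x - ∇ U x := fun x hx => by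
    have h1 : χ x = 1 := (hχ1 x hx).eq_of_nhds
    have h2 : ∇ χ x = 0 := by
      rw [(hχ1 x hx).gradient_eq]
      simp
    simp only [hH, h1, h2, hgV, one_smul, smul_zero, add_zero]
  have hwC : ∀ x, 0 < w x → x ∈ C := fun x hx => by
    have hχx : χ x ≠ 0 := fun h0 => by simp [hw, h0] at hx
    have hxD : x ∈ D := hχD (subset_tsupport χ hχx)
    have hux : 0 < u x := pos_of_mul_pos_left hx (hχ0 x)
    refine ⟨subset_closure hxD, ?_⟩
    simp only [hu, hV] at hux
    simp only [Set.mem_preimage, Set.mem_Ici]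
    linarith
  have hwx₀ : w x₀ = 2 * c := by
    have hx₀C : x₀ ∈ C := ⟨subset_closure hx₀, by
      simp only [Set.mem_preimage, Set.mem_Ici]
      linarith⟩
    have h1 : χ x₀ = 1 := (hχ1 x₀ hx₀C).eq_of_nhds
    simp only [hw, hu, hV, h1, mul_one]
    linarith
  -- the test functions
  set ψ := smoothTruncation c with hψdef
  have hψ : ContDiff ℝ ∞ ψ := contDiff_smoothTruncation c
  set φ : ℕ → EuclideanSpace ℝ (Fin n) → ℝ := fun k x => ψ (mollify k w x) with hφ
  have hφs : ∀ k, ContDiff ℝ ∞ (φ k) := fun k =>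
    hψ.comp (contDiff_mollify k hwc.locallyIntegrable)
  have hφ0 : ∀ k x, 0 ≤ φ k x := fun k x => smoothTruncation_nonneg _ _
  have hφcs : ∀ k, HasCompactSupport (φ k) := fun k =>
    (hasCompactSupport_mollify k hwcs).comp_left (smoothTruncation_eq_zero hc0.le)
  have hunif := tendstoUniformly_mollify hwc hwcs
  -- `φ k` is nonzero only where the mollified `w` exceeds `c`; once the error is below `c`, `w` is
  -- positive there, which forces the point into `C`.
  have hφC : ∀ᶠ k in atTop, tsupport (φ k) ⊆ C := by
    filter_upwards [Metric.tendstoUniformly_iff.1 hunif c hc0] with k hk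
    refine closure_minimal (fun x hx => hwC x ?_) hCc.isClosed
    have h1 : c < mollify k w x := by
      by_contra! hle
      exact hx (smoothTruncation_eq_zero hle)
    have h2 := hk x
    rw [Real.dist_eq, abs_lt] at h2
    linarith
  have hgφ : ∀ k, MemLp (∇ (φ k)) (ENNReal.ofReal p) := fun k =>
    ((hφs k).of_le (by simp)).continuous_gradient.memLp_of_hasCompactSupport (hφcs k).gradient
  obtain ⟨hΨ, hlim⟩ := tendsto_eLpNorm_gradient_comp_mollify_sub hp1 hwc hwcs hHL hwH hψ
  have hpq : (p / (p - 1)).HolderConjugate p :=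
    (Real.HolderConjugate.conjExponent (by linarith)).symm
  have hgrad0 : ∀ k, tsupport (φ k) ⊆ C → ∀ x, x ∉ C → ∇ (φ k) x = 0 := fun k hk x hx =>
    gradient_eq_zero_of_notMem_tsupport fun h' => hx (hk h')
  have hCm : MeasurableSet C := hCc.measurableSet
  -- the two fluxes, restricted to the contact region
  have hΦG : MemLp (C.indicator fun x => ‖G x‖ ^ (p - 2) • G x)
      (ENNReal.ofReal (p / (p - 1))) volume :=
    (memLp_indicator_iff_restrict hCm).2 (memLp_rpow_norm_smul hp (hG.memLpLoc_grad C hCc hCD))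
  have hΦU : MemLp (C.indicator fun x => ‖∇ U x‖ ^ (p - 2) • ∇ U x)
      (ENNReal.ofReal (p / (p - 1))) volume :=
    (memLp_indicator_iff_restrict hCm).2
      (memLp_rpow_norm_smul hp (MemLpLoc.of_continuous hgU C hCc hCD))
  -- For large `k` the test gradients vanish off `C`, so the indicator leaves the tested equation
  -- unchanged while making the flux globally integrable.
  have hIG : ∫ x, inner ℝ (C.indicator (fun x => ‖G x‖ ^ (p - 2) • G x) x)
      (deriv ψ (w x) • H x) = 0 := by
    refine tendsto_nhds_unique (tendsto_integral_inner hpq hΦG hΨ hgφ hlim) ?_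
    refine tendsto_const_nhds.congr' ?_
    filter_upwards [hφC] with k hk
    rw [← hGh (φ k) ⟨hφs k, hφcs k, hk.trans hCD⟩]
    congr 1
    funext x
    by_cases hx : x ∈ C
    · rw [Set.indicator_of_mem hx, real_inner_smul_left]
    · rw [hgrad0 k hk x hx, inner_zero_right, inner_zero_right, mul_zero]
  have hIU : 0 ≤ ∫ x, inner ℝ (C.indicator (fun x => ‖∇ U x‖ ^ (p - 2) • ∇ U x) x)
      (deriv ψ (w x) • H x) := by
    refine ge_of_tendsto (tendsto_integral_inner hpq hΦU hΨ hgφ hlim) ?_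
    filter_upwards [hφC] with k hk
    refine (hU.integral_nonneg hp (hφs k) (hφcs k) (hφ0 k)).trans_eq ?_
    congr 1
    funext x
    by_cases hx : x ∈ C
    · rw [Set.indicator_of_mem hx, real_inner_smul_left]
    · rw [hgrad0 k hk x hx, inner_zero_right, inner_zero_right, mul_zero]
  have hiG := integrable_inner_of_holderConjugate hpq hΦG hΨ
  have hiU := integrable_inner_of_holderConjugate hpq hΦU hΨ
  have hψ'0 : ∀ x, x ∉ C → deriv ψ (w x) = 0 := fun x hx =>
    deriv_smoothTruncation_eq_zero (lt_of_le_of_lt (not_lt.1 fun h' => hx (hwC x h')) hc0)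
  have hdiff : ∀ x, inner ℝ (C.indicator (fun x => ‖G x‖ ^ (p - 2) • G x) x)
      (deriv ψ (w x) • H x) - inner ℝ (C.indicator (fun x => ‖∇ U x‖ ^ (p - 2) • ∇ U x) x)
      (deriv ψ (w x) • H x) = deriv ψ (w x) *
        inner ℝ (‖G x‖ ^ (p - 2) • G x - ‖∇ U x‖ ^ (p - 2) • ∇ U x) (G x - ∇ U x) := fun x => by
    by_cases hx : x ∈ C
    · rw [Set.indicator_of_mem hx, Set.indicator_of_mem hx, ← inner_sub_left,
        real_inner_smul_right, hHC x hx]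
    · rw [hψ'0 x hx, zero_smul, inner_zero_right, inner_zero_right, zero_mul, sub_zero]
  have hnonneg : ∀ x, 0 ≤ deriv ψ (w x) *
      inner ℝ (‖G x‖ ^ (p - 2) • G x - ‖∇ U x‖ ^ (p - 2) • ∇ U x) (G x - ∇ U x) := fun x =>
    mul_nonneg (deriv_smoothTruncation_nonneg _ _)
      (inner_rpow_norm_smul_sub_nonneg (by linarith) _ _)
  -- The integrand of the difference is nonnegative by monotonicity and its integral is at most
  -- zero, so it vanishes almost everywhere. Strict monotonicity then kills `H` wherever `ψ'(w)` is
  -- nonzero.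
  have hae : ∀ᵐ x, deriv ψ (w x) • H x = 0 := by
    have hint := hiG.sub hiU
    have heq := integral_sub hiG hiU
    simp only [hdiff] at heq
    have hint' : Integrable fun x => deriv ψ (w x) *
        inner ℝ (‖G x‖ ^ (p - 2) • G x - ‖∇ U x‖ ^ (p - 2) • ∇ U x) (G x - ∇ U x) :=
      hint.congr (Eventually.of_forall hdiff)
    have h0 : ∫ x, deriv ψ (w x) *
        inner ℝ (‖G x‖ ^ (p - 2) • G x - ‖∇ U x‖ ^ (p - 2) • ∇ U x) (G x - ∇ U x) = 0 :=
      le_antisymm (by rw [heq, hIG]; linarith) (integral_nonneg hnonneg)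
    rw [integral_eq_zero_iff_of_nonneg hnonneg hint'] at h0
    filter_upwards [h0] with x hx
    by_cases hxC : x ∈ C
    · rcases mul_eq_zero.1 hx with h1 | h1
      · rw [h1, zero_smul]
      · rw [hHC x hxC, eq_of_inner_rpow_norm_smul_sub_eq_zero (by linarith) h1, sub_self, smul_zero]
    · rw [hψ'0 x hxC, zero_smul]
  -- the test functions have vanishing integral in the limit
  let i₀ : Fin n := ⟨0, hn⟩
  have hcoord : Continuous fun x : EuclideanSpace ℝ (Fin n) =>
      x i₀ • EuclideanSpace.basisFun (Fin n) ℝ i₀ :=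
    (EuclideanSpace.proj i₀ : EuclideanSpace ℝ (Fin n) →L[ℝ] ℝ).continuous.smul continuous_const
  have hΦ1 : MemLp (C.indicator fun x : EuclideanSpace ℝ (Fin n) =>
      x i₀ • EuclideanSpace.basisFun (Fin n) ℝ i₀) (ENNReal.ofReal (p / (p - 1))) volume :=
    (memLp_indicator_iff_restrict hCm).2 (MemLpLoc.of_continuous hcoord C hCc hCD)
  -- `∫ φ k = -∫ x_i ∂_i φ k`, where `x_i` is bounded on `C` and the gradients tend to zero in
  -- `L^p`.
  have hlim0 : Tendsto (fun k => ∫ x, φ k x) atTop (𝓝 0) := by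
    have h1 := tendsto_integral_inner hpq hΦ1 hΨ hgφ hlim
    have h2 : ∫ x, inner ℝ (C.indicator (fun x : EuclideanSpace ℝ (Fin n) =>
        x i₀ • EuclideanSpace.basisFun (Fin n) ℝ i₀) x) (deriv ψ (w x) • H x) = 0 := by
      rw [← integral_zero (EuclideanSpace ℝ (Fin n)) ℝ]
      refine integral_congr_ae ?_
      filter_upwards [hae] with x hx
      rw [hx, inner_zero_right]
    rw [h2] at h1
    have h3 := h1.neg
    rw [neg_zero] at h3
    refine h3.congr' ?_
    filter_upwards [hφC] with k hk
    rw [neg_eq_iff_eq_neg, ← integral_inner_basis_mul_fderiv i₀ ((hφs k).of_le (by simp)) (hφcs k)]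
    congr 1
    funext x
    by_cases hx : x ∈ C
    · rw [Set.indicator_of_mem hx, real_inner_smul_left, real_inner_comm, inner_gradient_left]
    · rw [hgrad0 k hk x hx, inner_zero_right, ← inner_gradient_left, hgrad0 k hk x hx,
        inner_zero_left, mul_zero]
  have hlim1 : Tendsto (fun k => ∫ x, φ k x) atTop (𝓝 (∫ x, ψ (w x))) := by
    refine tendsto_integral_filter_of_dominated_convergence (C.indicator fun _ => (1 : ℝ))
      (Eventually.of_forall fun k => (hφs k).continuous.aestronglyMeasurable) ?_
      ((integrable_indicator_iff hCm).2 (integrableOn_const hCc.measure_lt_top.ne)) ?_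
    · filter_upwards [hφC] with k hk
      refine Eventually.of_forall fun x => ?_
      rw [Real.norm_of_nonneg (hφ0 k x)]
      by_cases hx : x ∈ C
      · rw [Set.indicator_of_mem hx]
        exact smoothTruncation_le_one _ _
      · rw [Set.indicator_of_notMem hx, image_eq_zero_of_notMem_tsupport fun h' => hx (hk h')]
    · exact Eventually.of_forall fun x =>
        (hψ.continuous.tendsto _).comp (hunif.tendsto_at x)
  -- The limit `ψ ∘ w` would have zero integral, yet it is continuous, nonnegative and positive at
  -- `x₀`, where `w = 2c > c`.
  have hzero := tendsto_nhds_unique hlim1 hlim0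
  have hpos : 0 < ∫ x, ψ (w x) :=
    Continuous.integral_pos_of_hasCompactSupport_nonneg_nonzero (hψ.continuous.comp hwc)
      (hwcs.comp_left (smoothTruncation_eq_zero hc0.le)) (fun x => smoothTruncation_nonneg _ _)
      (x := x₀) (smoothTruncation_pos (by rw [hwx₀]; linarith)).ne'
  exact hpos.ne' hzero

end Comparison

/-! ### Convergence, continuity and approximation of the superposition -/

section Superposition

open Filter Topology

variable {n : ℕ} {p α : ℝ}

theorem norm_sub_rpow_le (hα0 : 0 ≤ α) (hα1 : α ≤ 1) (x x₀ y : EuclideanSpace ℝ (Fin n)) :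
    ‖x - y‖ ^ α ≤ ‖x - x₀‖ ^ α + ‖x₀ - y‖ ^ α := by
  refine (Real.rpow_le_rpow (norm_nonneg _) (norm_sub_le_norm_sub_add_norm_sub x x₀ y) hα0).trans ?_
  exact Real.rpow_add_le_add_rpow (norm_nonneg _) (norm_nonneg _) hα0 hα1

variable {a : ℕ → ℝ} {y : ℕ → EuclideanSpace ℝ (Fin n)} {x₀ : EuclideanSpace ℝ (Fin n)}

/-- Subadditivity of `t ↦ t^α` for `0 ≤ α ≤ 1` gives a summable majorant uniform on balls about
`x₀`, hence both convergence everywhere and local uniformity. -/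
theorem norm_superposition_term_le (hα0 : 0 ≤ α) (hα1 : α ≤ 1) (ha : ∀ i, 0 ≤ a i) {R : ℝ}
    {x : EuclideanSpace ℝ (Fin n)} (hx : ‖x - x₀‖ ≤ R) (i : ℕ) :
    ‖a i * ‖x - y i‖ ^ α‖ ≤ a i * R ^ α + a i * ‖x₀ - y i‖ ^ α := by
  rw [Real.norm_of_nonneg (mul_nonneg (ha i) (Real.rpow_nonneg (norm_nonneg _) _)), ← mul_add]
  refine mul_le_mul_of_nonneg_left ((norm_sub_rpow_le hα0 hα1 x x₀ (y i)).trans ?_) (ha i)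
  exact add_le_add_left (Real.rpow_le_rpow (norm_nonneg _) hx hα0) _

theorem summable_superposition (hα0 : 0 ≤ α) (hα1 : α ≤ 1) (ha : ∀ i, 0 ≤ a i) (hA : Summable a)
    (hconv : Summable fun i => a i * ‖x₀ - y i‖ ^ α) (x : EuclideanSpace ℝ (Fin n)) :
    Summable fun i => a i * ‖x - y i‖ ^ α :=
  Summable.of_norm_bounded ((hA.mul_right (‖x - x₀‖ ^ α)).add hconv)
    fun i => norm_superposition_term_le hα0 hα1 ha le_rfl i

theorem continuous_superposition_term (hα0 : 0 ≤ α) (i : ℕ) :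
    Continuous fun x : EuclideanSpace ℝ (Fin n) => a i * ‖x - y i‖ ^ α :=
  continuous_const.mul ((continuous_id.sub continuous_const).norm.rpow_const fun _ => Or.inr hα0)

theorem continuous_superposition (hα0 : 0 ≤ α) (hα1 : α ≤ 1) (ha : ∀ i, 0 ≤ a i)
    (hA : Summable a) (hconv : Summable fun i => a i * ‖x₀ - y i‖ ^ α) :
    Continuous fun x => ∑' i, a i * ‖x - y i‖ ^ α := by
  refine continuous_iff_continuousAt.2 fun x => ?_
  have hc : ContinuousOn (fun x => ∑' i, a i * ‖x - y i‖ ^ α)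
      (Metric.ball x₀ (‖x - x₀‖ + 1)) :=
    continuousOn_tsum (fun i => (continuous_superposition_term hα0 i).continuousOn)
      ((hA.mul_right ((‖x - x₀‖ + 1) ^ α)).add hconv) fun i z hz =>
        norm_superposition_term_le hα0 hα1 ha (mem_ball_iff_norm.1 hz).le i
  refine hc.continuousAt (Metric.isOpen_ball.mem_nhds ?_)
  rw [mem_ball_iff_norm]
  linarith

theorem rpow_le_sq_add_rpow (hα0 : 0 ≤ α) {r d : ℝ} (hr : 0 ≤ r) (hd : 0 ≤ d) :
    r ^ α ≤ (r ^ 2 + d) ^ (α / 2) := by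
  have h : r ^ α = (r ^ 2) ^ (α / 2) := by
    rw [← Real.rpow_natCast, ← Real.rpow_mul hr]
    congr 1
    push_cast
    ring
  rw [h]
  exact Real.rpow_le_rpow (sq_nonneg r) (le_add_of_nonneg_right hd) (by linarith)

/-- The error `d^(α/2)` does not depend on `r`, so the regularisation is uniform in the point and in
the pole. -/
theorem sq_add_rpow_le (hα0 : 0 ≤ α) (hα1 : α ≤ 1) {r d : ℝ} (hr : 0 ≤ r) (hd : 0 ≤ d) :
    (r ^ 2 + d) ^ (α / 2) ≤ r ^ α + d ^ (α / 2) := by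
  have h : r ^ α = (r ^ 2) ^ (α / 2) := by
    rw [← Real.rpow_natCast, ← Real.rpow_mul hr]
    congr 1
    push_cast
    ring
  rw [h]
  exact Real.rpow_add_le_add_rpow (sq_nonneg r) hd (by linarith) (by linarith)

/-- The superposition is a locally uniform limit of smooth dominative supersolutions. -/
theorem exists_isDominativeSuper_approx (hn : 1 ≤ n) (hp : 2 < p) (hpn : (n : ℝ) < p)
    (ha : ∀ i, 0 ≤ a i) (hA : Summable a)
    (hconv : Summable fun i => a i * ‖x₀ - y i‖ ^ ((p - n) / (p - 1)))
    {K : EuclideanSpace ℝ (Fin n) → ℝ} (hK : ConcaveOn ℝ Set.univ K)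
    {S : Set (EuclideanSpace ℝ (Fin n))} (hS : IsCompact S) {ε : ℝ} (hε : 0 < ε) :
    ∃ U, IsDominativeSuper p U ∧ ∀ x ∈ S,
      |U x - (-(∑' i, a i * ‖x - y i‖ ^ ((p - n) / (p - 1))) + K x)| ≤ ε := by
  have hn' : (1 : ℝ) ≤ n := by exact_mod_cast hn
  set α := (p - n) / (p - 1) with hα
  have hα0 : 0 < α := div_pos (by linarith) (by linarith)
  have hα1 : α ≤ 1 := by rw [hα, div_le_one (by linarith)]; linarith
  have hKc : Continuous K := continuousOn_univ.1 (hK.continuousOn isOpen_univ)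
  obtain ⟨R, hR⟩ := hS.isBounded.subset_closedBall x₀
  have hunif : TendstoUniformlyOn (fun N x => ∑ i ∈ Finset.range N, a i * ‖x - y i‖ ^ α)
      (fun x => ∑' i, a i * ‖x - y i‖ ^ α) atTop S :=
    tendstoUniformlyOn_tsum_nat ((hA.mul_right (R ^ α)).add hconv) fun i x hx =>
      norm_superposition_term_le hα0.le hα1 ha (mem_closedBall_iff_norm.1 (hR hx)) i
  obtain ⟨N, hN⟩ := (Metric.tendstoUniformlyOn_iff.1 hunif (ε / 3) (by linarith)).exists
  obtain ⟨k, hk⟩ := (Metric.tendstoUniformlyOn_iff.1 (tendstoUniformlyOn_mollify hKc hS) (ε / 3)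
    (by linarith)).exists
  -- `d` is chosen after `N`, since the total regularisation error is weighted by the partial sum of
  -- the `a i`.
  obtain ⟨d, hd, hdε⟩ : ∃ d : ℝ, 0 < d ∧ (∑ i ∈ Finset.range N, a i) * d ^ (α / 2) < ε / 3 := by
    have hc : Continuous fun d : ℝ => (∑ i ∈ Finset.range N, a i) * d ^ (α / 2) :=
      continuous_const.mul (continuous_id.rpow_const fun _ => Or.inr (by linarith))
    have ht := (hc.tendsto 0).mono_left (nhdsWithin_le_nhds (s := Set.Ioi 0))
    rw [Real.zero_rpow (by linarith), mul_zero] at ht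
    obtain ⟨d, h1, h2⟩ :=
      ((ht.eventually (gt_mem_nhds (show 0 < ε / 3 by linarith))).and self_mem_nhdsWithin).exists
    exact ⟨d, h2, h1⟩
  refine ⟨fun x => (∑ i ∈ Finset.range N, a i * -(‖x - y i‖ ^ 2 + d) ^ (α / 2)) + mollify k K x,
    ?_, fun x hx => ?_⟩
  · exact (IsDominativeSuper.sum _ fun i _ =>
      (isDominativeSuper_neg_norm_sub_sq_add_rpow hp hpn hn (y i) hd).const_mul (ha i)).add
      (IsDominativeSuper.of_concave hp.le (contDiff_mollify k hKc.locallyIntegrable)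
        (hK.mollify hKc k))
  · have h1 := hN x hx
    have h2 := hk x hx
    rw [Real.dist_eq, abs_lt] at h1 h2
    have h3 : ∑ i ∈ Finset.range N, a i * ‖x - y i‖ ^ α ≤
        ∑ i ∈ Finset.range N, a i * (‖x - y i‖ ^ 2 + d) ^ (α / 2) :=
      Finset.sum_le_sum fun i _ => mul_le_mul_of_nonneg_left
        (rpow_le_sq_add_rpow hα0.le (norm_nonneg _) hd.le) (ha i)
    have h4 : ∑ i ∈ Finset.range N, a i * (‖x - y i‖ ^ 2 + d) ^ (α / 2) ≤
        ∑ i ∈ Finset.range N, a i * ‖x - y i‖ ^ α +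
          (∑ i ∈ Finset.range N, a i) * d ^ (α / 2) := by
      rw [Finset.sum_mul, ← Finset.sum_add_distrib]
      refine Finset.sum_le_sum fun i _ => ?_
      rw [← mul_add]
      exact mul_le_mul_of_nonneg_left (sq_add_rpow_le hα0.le hα1 (norm_nonneg _) hd.le) (ha i)
    simp only [mul_neg, Finset.sum_neg_distrib]
    rw [abs_le]
    constructor <;> linarith [h1.1, h1.2, h2.1, h2.2]

end Superposition

/-! ### Passage to the limit in the comparison principle -/

theorem mainTheorem5 (n : ℕ) (hn : 1 ≤ n) (p : ℝ) (hp : 2 < p) (hpn : (n : ℝ) < p)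
    (a : ℕ → ℝ) (ha : ∀ i, 0 ≤ a i) (hA : Summable a)
    (y : ℕ → EuclideanSpace ℝ (Fin n))
    (K : EuclideanSpace ℝ (Fin n) → ℝ) (hK : ConcaveOn ℝ Set.univ K)
    (hconv : ∃ x₀ : EuclideanSpace ℝ (Fin n),
      Summable fun i => a i * ‖x₀ - y i‖ ^ ((p - n) / (p - 1))) :
    (∀ x : EuclideanSpace ℝ (Fin n),
      Summable fun i => a i * ‖x - y i‖ ^ ((p - n) / (p - 1))) ∧
    IsPSuperharmonicOn p Set.univ (fun x : EuclideanSpace ℝ (Fin n) =>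
      ((-(∑' i, a i * ‖x - y i‖ ^ ((p - n) / (p - 1))) + K x : ℝ) : EReal)) := by
  obtain ⟨x₀, hx₀⟩ := hconv
  have hn' : (1 : ℝ) ≤ n := by exact_mod_cast hn
  have hα0 : 0 ≤ (p - n) / (p - 1) := div_nonneg (by linarith) (by linarith)
  have hα1 : (p - n) / (p - 1) ≤ 1 := by rw [div_le_one (by linarith)]; linarith
  have hKc : Continuous K := continuousOn_univ.1 (hK.continuousOn isOpen_univ)
  have hW := (continuous_superposition hα0 hα1 ha hA hx₀).neg.add hKc
  refine ⟨summable_superposition hα0 hα1 ha hA hx₀, fun x _ => EReal.coe_ne_bot _,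
    ⟨0, Set.mem_univ _, EReal.coe_ne_top _⟩,
    (continuous_coe_real_ereal.comp hW).lowerSemicontinuous.lowerSemicontinuousOn _, ?_⟩
  intro D h hD hDc _ hc hh hb x hx
  rw [EReal.coe_le_coe_iff]
  refine le_of_forall_pos_le_add fun ε hε => ?_
  obtain ⟨U, hU, hUW⟩ := exists_isDominativeSuper_approx hn hp hpn ha hA hx₀ hK hDc (half_pos hε)
  -- Raising `U` by `ε / 2` puts it above `W`, hence above `h`, on the boundary; inside it exceeds
  -- `W` by at most `ε`.
  have hU' : IsDominativeSuper p fun x => U x + ε / 2 :=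
    hU.add (IsDominativeSuper.of_concave hp.le contDiff_const (concaveOn_const _ convex_univ))
  have h1 := hh.le_of_le_frontier hn hp hD hDc hc hU' (fun z hz => by
    have h2 := EReal.coe_le_coe_iff.1 (hb z hz)
    have h3 := (abs_le.1 (hUW z (frontier_subset_closure hz))).1
    linarith) hx
  have h4 := (abs_le.1 (hUW x (subset_closure hx))).2
  linarith
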